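/- Let $m_0,m\ge 1$ be integers, let $A_{-1},A_0,A_1$ be nonnegative real $m\times m$ matrices, and let $B_{-1}$, $B_0$, $B_1$ be nonnegative real matrices of sizes $m\times m_0$, $m_0\times m_0$, $m_0\times m$, respectively. Let $$K=\begin{pmatrix}B_0&B_1&0&0&\cdots\\ B_{-1}&A_0&A_1&0&\cdots\\ 0&A_{-1}&A_0&A_1&\cdots\\ 0&0&A_{-1}&A_0&\cdots\\ &\ddots&\ddots&\ddots&\ddots\end{pmatrix}$$ be the infinite nonnegative matrix with this QBD block structure. For $\theta\in\mathbb R$ put $$A_*(\theta)=e^{-\theta}A_{-1}+A_0+e^{\theta}A_1,\qquad C_*(\theta)=C_0+e^{\theta}A_1,\qquad C_0=B_{-1}\Big(\sum_{n\ge 0}B_0^n\Big)B_1+A_0,$$ where the entries of $\sum_n B_0^n$, $C_0$ and $C_*(\theta)$ are computed in $[0,\infty]$ with $0\cdot\infty=0$. Let $\gamma(\theta)$ be the Perron--Frobenius eigenvalue (spectral radius) of $A_*(\theta)$. All vector inequalities are entrywise, and $h>0$ means that all entries of $h$ are positive (and finite). Define $$\Gamma_+^{(1d)}=\{\theta\in\mathbb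 R:\gamma(\theta)\le 1\},$$ $$\Gamma_{0+}^{(1d)}=\{\theta\in\mathbb R:\exists h>0,\ A_*(\theta)h\le h,\ C_*(\theta)h\le h\},\qquad \Gamma_{0+}^{(1e)}=\{\theta\in\mathbb R:\exists h>0,\ A_*(\theta)h=h,\ C_*(\theta)h\le h\}.$$ Let $c_p(K)=\sup\{u\ge 0:\sum_{n\ge 0}u^nK^n<\infty \text{ entrywise}\}$ be the convergence parameter of $K$. Assume that $K$ is irreducible (for all indices $i,j$ there is $n\ge 1$ with $(K^n)_{ij}>0$) and that $A_*(0)$ is irreducible. Then $c_p(K)\ge 1$ if and only if $K$ has a superharmonic vector, that is, a vector $y>0$ with $Ky\le y$. Moreover: (a) If $\Gamma_{0+}^{(1d)}\neq\emptyset$, then $c_p(K)\ge 1$. (b) Suppose in addition that for each $\theta\in\Gamma_+^{(1d)}$, with $h(\theta)>0$ the right eigenvector of $A_*(\theta)$ for the eigenvalue $\gamma(\theta)$ (unique up to a positive factor), there are a vector $h^{(0)}(\theta)\in\mathbb R^{m_0}$, $h^{(0)}(\theta)>0$, and real numbers $c_0(\theta),c_1(\theta)$, at least one of which equals $1$, such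 that $$B_0h^{(0)}(\theta)+e^{\theta}B_1h(\theta)=c_0(\theta)h^{(0)}(\theta),$$ $$e^{-\theta}B_{-1}h^{(0)}(\theta)+A_0h(\theta)+e^{\theta}A_1h(\theta)=c_1(\theta)h(\theta).$$ Then $c_p(K)\ge 1$ if and only if $\Gamma_{0+}^{(1d)}\neq\emptyset$; and likewise $c_p(K)\ge 1$ if and only if $\Gamma_{0+}^{(1e)}\neq\emptyset$. -/

import Mathlib

open scoped ENNReal NNReal Matrix

noncomputable section

namespace QBD

/-! ### Nonnegative matrices over an arbitrary (possibly infinite) index set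

Products and sums of nonnegative entries are computed in `[0, ∞]`, with `0 * ∞ = 0`. -/

/-- The powers `T ^ n` of a nonnegative matrix with a possibly infinite index set. -/
def npow {ι : Type*} [DecidableEq ι] (T : Matrix ι ι ℝ≥0∞) : ℕ → Matrix ι ι ℝ≥0∞
  | 0 => 1
  | n + 1 => fun i j => ∑' k, T i k * npow T n k j

/-- `(I - T)⁻¹ := ∑ n, T ^ n`, whose entries are allowed to be infinite. -/
def neumann {ι : Type*} [DecidableEq ι] (T : Matrix ι ι ℝ≥0∞) : Matrix ι ι ℝ≥0∞ :=
  fun i j => ∑' n, npow T n i j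

/-- The entries of a nonnegative real matrix, seen in `[0, ∞]`. -/
def toENN {ι κ : Type*} (T : Matrix ι κ ℝ) : Matrix ι κ ℝ≥0∞ :=
  T.map ENNReal.ofReal

/-- The convergence parameter
`c_p(T) = sup {u ≥ 0 | ∑ n, u ^ n T ^ n < ∞}` (entrywise finiteness) of a nonnegative matrix. -/
def convParam {ι : Type*} [DecidableEq ι] (T : Matrix ι ι ℝ) : ℝ≥0∞ :=
  sSup {v : ℝ≥0∞ | ∃ u : ℝ≥0, v = (u : ℝ≥0∞) ∧
    ∀ i j, ∑' n, (u : ℝ≥0∞) ^ n * npow (toENN T) n i j < ∞}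

/-- `y` is a superharmonic vector of the nonnegative matrix `T`: `y > 0` and `T y ≤ y`. -/
def IsSuperharmonic {ι : Type*} (T : Matrix ι ι ℝ) (y : ι → ℝ) : Prop :=
  (∀ i, 0 < y i) ∧
    ∀ i, ∑' j, ENNReal.ofReal (T i j) * ENNReal.ofReal (y j) ≤ ENNReal.ofReal (y i)

/-- The Perron-Frobenius eigenvalue of a finite nonnegative square matrix: its spectral radius. -/
def pfEigenvalue {m : ℕ} (T : Matrix (Fin m) (Fin m) ℝ) : ℝ :=
  (spectralRadius ℂ (T.map (algebraMap ℝ ℂ))).toReal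

/-! ### Matrices with QBD block structure -/

/-- The blocks of a nonnegative matrix with QBD block structure. Here `Am, A0, A1` are
`A₋₁, A₀, A₁`, and `Bm, B0, B1` are `B₋₁, B₀, B₁`. -/
structure Blocks (m₀ m : ℕ) where
  Am : Matrix (Fin m) (Fin m) ℝ
  A0 : Matrix (Fin m) (Fin m) ℝ
  A1 : Matrix (Fin m) (Fin m) ℝ
  Bm : Matrix (Fin m) (Fin m₀) ℝ
  B0 : Matrix (Fin m₀) (Fin m₀) ℝ
  B1 : Matrix (Fin m₀) (Fin m) ℝ
  Am_nonneg : ∀ i j, 0 ≤ Am i j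
  A0_nonneg : ∀ i j, 0 ≤ A0 i j
  A1_nonneg : ∀ i j, 0 ≤ A1 i j
  Bm_nonneg : ∀ i j, 0 ≤ Bm i j
  B0_nonneg : ∀ i j, 0 ≤ B0 i j
  B1_nonneg : ∀ i j, 0 ≤ B1 i j

namespace Blocks

variable {m₀ m : ℕ} (D : Blocks m₀ m)

/-- The index set of `K`: `Sum.inl i` is state `i` of block `0`, and `Sum.inr (n, i)` is
state `i` of block `n + 1`. -/
abbrev Index (m₀ m : ℕ) : Type := Fin m₀ ⊕ (ℕ × Fin m)

/-- The block tridiagonal matrix `K` with block rows `(B₀, B₁, 0, …)`, `(B₋₁, A₀, A₁, 0, …)`,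
`(0, A₋₁, A₀, A₁, 0, …)`, `(0, 0, A₋₁, A₀, A₁, 0, …)`, …. -/
def K : Matrix (Index m₀ m) (Index m₀ m) ℝ
  | .inl i, .inl j => D.B0 i j
  | .inl i, .inr (l, j) => if l = 0 then D.B1 i j else 0
  | .inr (k, i), .inl j => if k = 0 then D.Bm i j else 0
  | .inr (k, i), .inr (l, j) =>
      if l = k + 1 then D.A1 i j
      else if l = k then D.A0 i j
      else if k = l + 1 then D.Am i j
      else 0

/-- `A_*(θ) = e^{-θ} A₋₁ + A₀ + e^θ A₁`. -/
def Astar (θ : ℝ) : Matrix (Fin m) (Fin m) ℝ :=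
  Real.exp (-θ) • D.Am + D.A0 + Real.exp θ • D.A1

/-- `C₀ = B₋₁ (I - B₀)⁻¹ B₁ + A₀`, with entries in `[0, ∞]`. -/
def C0 : Matrix (Fin m) (Fin m) ℝ≥0∞ :=
  toENN D.Bm * neumann (toENN D.B0) * toENN D.B1 + toENN D.A0

/-- `C_*(θ) = C₀ + e^θ A₁`, with entries in `[0, ∞]`. -/
def Cstar (θ : ℝ) : Matrix (Fin m) (Fin m) ℝ≥0∞ :=
  D.C0 + toENN (Real.exp θ • D.A1)

/-- `Γ₊ = {θ | γ(A_*(θ)) ≤ 1}`, where `γ` is the Perron-Frobenius eigenvalue. -/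
def GammaPlus : Set ℝ := {θ | pfEigenvalue (D.Astar θ) ≤ 1}

/-- `Γ₀₊^{(1d)} = {θ | ∃ h > 0, A_*(θ) h ≤ h, C_*(θ) h ≤ h}`. -/
def GammaD : Set ℝ :=
  {θ | ∃ h : Fin m → ℝ, (∀ i, 0 < h i) ∧
    (∀ i, (D.Astar θ *ᵥ h) i ≤ h i) ∧
    ∀ i, (D.Cstar θ *ᵥ fun j => ENNReal.ofReal (h j)) i ≤ ENNReal.ofReal (h i)}

/-- `Γ₀₊^{(1e)} = {θ | ∃ h > 0, A_*(θ) h = h, C_*(θ) h ≤ h}`. -/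
def GammaE : Set ℝ :=
  {θ | ∃ h : Fin m → ℝ, (∀ i, 0 < h i) ∧
    D.Astar θ *ᵥ h = h ∧
    ∀ i, (D.Cstar θ *ᵥ fun j => ENNReal.ofReal (h j)) i ≤ ENNReal.ofReal (h i)}

/-- For each `θ ∈ Γ₊`, with `h` a positive Perron-Frobenius eigenvector of `A_*(θ)`
(it is unique up to a positive factor when `A_*(θ)` is irreducible, and the condition does not
depend on the factor), there are `h₀ > 0` and real `c₀, c₁`, one of which equals one, with
`B₀ h₀ + e^θ B₁ h = c₀ h₀` and `e^{-θ} B₋₁ h₀ + A₀ h + e^θ A₁ h = c₁ h`. -/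
def KeyAssumption : Prop :=
  ∀ θ ∈ D.GammaPlus, ∀ h : Fin m → ℝ, (∀ i, 0 < h i) →
    D.Astar θ *ᵥ h = pfEigenvalue (D.Astar θ) • h →
    ∃ (h₀ : Fin m₀ → ℝ) (c₀ c₁ : ℝ), (∀ i, 0 < h₀ i) ∧ (c₀ = 1 ∨ c₁ = 1) ∧
      D.B0 *ᵥ h₀ + Real.exp θ • (D.B1 *ᵥ h) = c₀ • h₀ ∧
      Real.exp (-θ) • (D.Bm *ᵥ h₀) + D.A0 *ᵥ h + Real.exp θ • (D.A1 *ᵥ h) = c₁ • h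

end Blocks

end QBD

end

/-! If `y > 0` and `T y ≤ y`, the entries of `T ^ n` are bounded by `y i / y j`, so the series `∑ u
^ n T ^ n` converges for `u < 1`. Conversely, columns of these series, normalised at one index, have
a limit point as `u → 1`, and the limit is superharmonic; irreducibility keeps it positive and
finite.

For (a), eliminate block `0`: if `θ` and `h` witness `GammaD`, the vector with blocks `e^{(n+1)θ} h`
above block `0`, completed by `(∑ B₀ ^ n) B₁ e^θ h` on block `0`, is superharmonic for `K`.

For (b), let `y` be superharmonic for `K`. Its generating function, cut at a suitable level near its
radius of convergence, almost satisfies `A_*(θ) F ≤ F`; compactness yields some `θ` with a genuine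
solution. The set of such `θ` is closed and bounded below. At its least element `θ'` the
Perron-Frobenius eigenvalue is `1`, with eigenvector `h'`, and it exceeds `1` to the left of `θ'`.
This makes `e^{nθ'} h'` minimal: an interior superharmonic sequence dominating `h'` at level `0`
dominates `e^{nθ'} h'` at every level (`IsInterior.exp_le`).

The key assumption extends `e^{(n+1)θ'} h'` to block `0` with factors `c₀`, `c₁`. If both are at
most `1`, then `θ'` lies in `GammaE`. Otherwise both are at least `1` and the extension `Z` is
subharmonic. The least `t` with `Z ≤ t y` on the first two blocks gives `Z ≤ t y` everywhere by
minimality, with equality at some index; `t y - Z` is a nonnegative superharmonic vector with a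
zero, so it vanishes. Then `Z` is superharmonic and `c₀, c₁ ≤ 1`, a contradiction. -/

open scoped ENNReal NNReal Matrix

noncomputable section

namespace QBD

open Filter Topology

/-! ### Superharmonic vectors and the convergence parameter -/

section General

variable {ι : Type*} {T : Matrix ι ι ℝ}

/-- In an irreducible matrix, a nonempty set of indices closed under transitions is everything. -/
theorem _root_.Matrix.IsIrreducible.mem_of_closed (hT : T.IsIrreducible) {s : Set ι}
    (hs : s.Nonempty) (hcl : ∀ i ∈ s, ∀ j, 0 < T i j → j ∈ s) (j : ι) : j ∈ s := by
  obtain ⟨o, ho⟩ := hs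
  let : Quiver ι := T.toQuiver
  obtain ⟨p, -⟩ := hT.connected o j
  induction p with
  | nil => exact ho
  | cons q e ih => exact hcl _ ih _ e.down

/-- In an irreducible matrix, a nonempty set of indices closed under predecessors is
everything. -/
theorem _root_.Matrix.IsIrreducible.mem_of_pred_closed (hT : T.IsIrreducible) {s : Set ι}
    (hs : s.Nonempty) (hcl : ∀ j ∈ s, ∀ i, 0 < T i j → i ∈ s) (i : ι) : i ∈ s := by
  by_contra hi
  obtain ⟨o, ho⟩ := hs
  exact hT.mem_of_closed (s := sᶜ) ⟨i, hi⟩ (fun a ha b hab hb => ha (hcl b hb a hab)) o ho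

/-- A superharmonic vector with values in `[0, ∞]` which is neither zero nor infinite at one
index is neither zero nor infinite anywhere. -/
theorem exists_isSuperharmonic (hT : T.IsIrreducible) (y : ι → ℝ≥0∞) (o : ι) (h0 : y o ≠ 0)
    (htop : y o ≠ ∞) (hy : ∀ i, ∑' j, ENNReal.ofReal (T i j) * y j ≤ y i) :
    (∀ i, y i ≠ 0) ∧ (∀ i, y i ≠ ∞) ∧ IsSuperharmonic T (fun i => (y i).toReal) := by
  have hle : ∀ i j, ENNReal.ofReal (T i j) * y j ≤ y i := fun i j =>
    (ENNReal.le_tsum (f := fun j => ENNReal.ofReal (T i j) * y j) j).trans (hy i)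
  have hpos : ∀ i, y i ≠ 0 := by
    refine hT.mem_of_pred_closed (s := {i | y i ≠ 0}) ⟨o, h0⟩ fun j hj i hij hi => ?_
    have := hle i j
    rw [hi, nonpos_iff_eq_zero, mul_eq_zero, ENNReal.ofReal_eq_zero] at this
    rcases this with h | h
    · exact absurd hij (not_lt.2 h)
    · exact hj h
  have hfin : ∀ i, y i ≠ ∞ := by
    refine hT.mem_of_closed (s := {i | y i ≠ ∞}) ⟨o, htop⟩ fun i hi j hij hj => ?_
    have := hle i j
    rw [hj, ENNReal.mul_top (by simpa using hij), top_le_iff] at this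
    exact hi this
  refine ⟨hpos, hfin, fun i => ENNReal.toReal_pos (hpos i) (hfin i), fun i => ?_⟩
  simpa [ENNReal.ofReal_toReal (hfin _)] using hy i

variable [DecidableEq ι]

theorem npow_mul_le {S : Matrix ι ι ℝ≥0∞} {y : ι → ℝ≥0∞} (hy : ∀ i, ∑' j, S i j * y j ≤ y i)
    (n : ℕ) (i j : ι) : npow S n i j * y j ≤ y i := by
  induction n generalizing i with
  | zero =>
    by_cases h : i = j
    · subst h
      simp [npow]
    · simp [npow, Matrix.one_apply_ne h]
  | succ n ih =>
    simp only [npow]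
    rw [← ENNReal.tsum_mul_right]
    refine (ENNReal.tsum_le_tsum fun k => ?_).trans (hy i)
    rw [mul_assoc]
    exact mul_le_mul_right (ih k) _

theorem one_le_convParam_of_isSuperharmonic {y : ι → ℝ} (hy : IsSuperharmonic T y) :
    1 ≤ convParam T := by
  refine le_of_forall_lt fun u hu => ?_
  obtain ⟨v, huv, hv⟩ := ENNReal.lt_iff_exists_nnreal_btwn.1 hu
  refine huv.trans_le (le_sSup ⟨v, rfl, fun i j => ?_⟩)
  have hj : ENNReal.ofReal (y j) ≠ 0 := by simpa using hy.1 j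
  have key : ∀ n, npow (toENN T) n i j ≤ ENNReal.ofReal (y i) / ENNReal.ofReal (y j) := fun n =>
    (ENNReal.le_div_iff_mul_le (Or.inl hj) (Or.inl ENNReal.ofReal_ne_top)).2
      (npow_mul_le (S := toENN T) (y := fun i => ENNReal.ofReal (y i)) hy.2 n i j)
  calc ∑' n, (v : ℝ≥0∞) ^ n * npow (toENN T) n i j
      ≤ ∑' n, (v : ℝ≥0∞) ^ n * (ENNReal.ofReal (y i) / ENNReal.ofReal (y j)) :=
        ENNReal.tsum_le_tsum fun n => mul_le_mul_right (key n) _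
    _ = (1 - (v : ℝ≥0∞))⁻¹ * (ENNReal.ofReal (y i) / ENNReal.ofReal (y j)) := by
        rw [ENNReal.tsum_mul_right, ENNReal.tsum_geometric]
    _ < ∞ := ENNReal.mul_lt_top (by simpa using hv)
        (ENNReal.div_lt_top ENNReal.ofReal_ne_top hj)

/-- The column at `o` of `∑ u ^ n T ^ n` satisfies `u T G ≤ G`, since the left side is the same
series without its term `n = 0`. After division by `G o`, a limit as `u → 1` takes the value `1` at
`o`, which excludes the values `0` and `∞` elsewhere. -/
theorem exists_isSuperharmonic_of_one_le_convParam [Nonempty ι] (hT : T.IsIrreducible)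
    (h : 1 ≤ convParam T) : ∃ y, IsSuperharmonic T y := by
  obtain ⟨o⟩ := ‹Nonempty ι›
  let u : ℕ → ℝ≥0∞ := fun k => 1 - ((k : ℝ≥0∞) + 1)⁻¹
  have hu1 : ∀ k, u k < 1 := fun k =>
    ENNReal.sub_lt_self ENNReal.one_ne_top one_ne_zero (by simp)
  have hu : Tendsto u atTop (𝓝 1) := by
    have h1 : Tendsto (fun k : ℕ => ((k : ℝ≥0∞) + 1)⁻¹) atTop (𝓝 0) := by
      have := (tendsto_add_atTop_iff_nat 1).2 ENNReal.tendsto_inv_nat_nhds_zero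
      simpa using this
    simpa using ENNReal.Tendsto.sub (tendsto_const_nhds (x := (1 : ℝ≥0∞))) h1 (by simp)
  let G : ℕ → ι → ℝ≥0∞ := fun k i => ∑' n, u k ^ n * npow (toENN T) n i o
  have hGtop : ∀ k i, G k i ≠ ∞ := fun k i => by
    obtain ⟨v, ⟨w, rfl, hw⟩, hkw⟩ := lt_sSup_iff.1 ((hu1 k).trans_le h)
    refine ne_top_of_le_ne_top (hw i o).ne (ENNReal.tsum_le_tsum fun n => ?_)
    gcongr
  have hGo : ∀ k, G k o ≠ 0 := fun k h0 => by
    have := (ENNReal.tsum_eq_zero.1 h0) 0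
    simp [npow] at this
  have hG : ∀ k i, u k * ∑' j, toENN T i j * G k j ≤ G k i := fun k i => by
    have : u k * ∑' j, toENN T i j * G k j =
        ∑' n, u k ^ (n + 1) * npow (toENN T) (n + 1) i o := by
      simp only [G, npow, ← ENNReal.tsum_mul_left]
      rw [ENNReal.tsum_comm]
      refine tsum_congr fun n => tsum_congr fun j => ?_
      ring
    rw [this]
    exact ENNReal.tsum_comp_le_tsum_of_injective (add_left_injective 1)
      (fun n => u k ^ n * npow (toENN T) n i o)
  let Y : ℕ → ι → ℝ≥0∞ := fun k i => G k i / G k o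
  have hY : ∀ k i, u k * ∑' j, toENN T i j * Y k j ≤ Y k i := fun k i => by
    simp only [Y, div_eq_mul_inv, ← mul_assoc]
    rw [ENNReal.tsum_mul_right, ← mul_assoc]
    exact mul_le_mul_left (hG k i) _
  -- As `[0, ∞]` is compact, all coordinates converge at once along an ultrafilter, whatever the
  -- size of `ι`.
  let U : Ultrafilter ℕ := hyperfilter ℕ
  have hUtop : (U : Filter ℕ) ≤ atTop := by
    simpa [U, Nat.cofinite_eq_atTop] using hyperfilter_le_cofinite (α := ℕ)
  let y : ι → ℝ≥0∞ := fun i => (U.map fun k => Y k i).lim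
  have hlim : ∀ i, Tendsto (fun k => Y k i) U (𝓝 (y i)) := fun i =>
    Ultrafilter.le_nhds_lim (U.map fun k => Y k i)
  have hyo : y o = 1 := by
    refine tendsto_nhds_unique (hlim o) ?_
    have : (fun k => Y k o) = fun _ => 1 := funext fun k =>
      ENNReal.div_self (hGo k) (hGtop k o)
    rw [this]
    exact tendsto_const_nhds
  refine ⟨_, (exists_isSuperharmonic hT y o (by simp [hyo]) (by simp [hyo]) fun i => ?_).2.2⟩
  -- Fatou's argument: pass to the limit in finite partial sums, where multiplication by a finite
  -- constant is continuous.
  rw [ENNReal.tsum_eq_iSup_sum]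
  refine iSup_le fun s => ?_
  have h1 : Tendsto (fun k => u k * ∑ j ∈ s, toENN T i j * Y k j) U
      (𝓝 (1 * ∑ j ∈ s, toENN T i j * y j)) := by
    refine ENNReal.Tendsto.mul (hu.mono_left hUtop) (Or.inl one_ne_zero)
      (tendsto_finsetSum _ fun j _ => ?_) (Or.inr ENNReal.one_ne_top)
    exact ENNReal.Tendsto.const_mul (hlim j) (Or.inr (by simp [toENN]))
  rw [one_mul] at h1
  exact le_of_tendsto_of_tendsto' h1 (hlim i) fun k =>
    (mul_le_mul_right (ENNReal.sum_le_tsum s) _).trans (hY k i)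

end General

/-! ### Perron-Frobenius theory for finite matrices -/

section PerronFrobenius

variable {m : ℕ} {T : Matrix (Fin m) (Fin m) ℝ}

theorem mulVec_mono {n : ℕ} {T : Matrix (Fin n) (Fin m) ℝ} (hT : ∀ i j, 0 ≤ T i j)
    {v w : Fin m → ℝ} (h : ∀ i, v i ≤ w i) (i : Fin n) :
    (T *ᵥ v) i ≤ (T *ᵥ w) i := by
  simp only [Matrix.mulVec, dotProduct]
  exact Finset.sum_le_sum fun j _ => mul_le_mul_of_nonneg_left (h j) (hT i j)

theorem mulVec_nonneg {n : ℕ} {T : Matrix (Fin n) (Fin m) ℝ} (hT : ∀ i j, 0 ≤ T i j)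
    {v : Fin m → ℝ} (hv : ∀ i, 0 ≤ v i) (i : Fin n) : 0 ≤ (T *ᵥ v) i := by
  simp only [Matrix.mulVec, dotProduct]
  exact Finset.sum_nonneg fun j _ => mul_nonneg (hT i j) (hv j)

theorem mul_le_mulVec {n : ℕ} {T : Matrix (Fin n) (Fin m) ℝ} (hT : ∀ i j, 0 ≤ T i j)
    {v : Fin m → ℝ} (hv : ∀ i, 0 ≤ v i) (i : Fin n) (j : Fin m) : T i j * v j ≤ (T *ᵥ v) i :=
  Finset.single_le_sum (f := fun j => T i j * v j) (fun k _ => mul_nonneg (hT i k) (hv k))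
    (Finset.mem_univ j)

/-- A nonnegative nonzero vector with `T h ≤ r h` for an irreducible matrix is positive. -/
theorem pos_of_mulVec_le (hT : T.IsIrreducible) {h : Fin m → ℝ} {r : ℝ}
    (h0 : ∀ i, 0 ≤ h i) (h1 : ∃ i, h i ≠ 0) (hr : ∀ i, (T *ᵥ h) i ≤ r * h i) (i : Fin m) :
    0 < h i := by
  refine hT.mem_of_pred_closed (s := {i | 0 < h i}) ?_ ?_ i
  · obtain ⟨o, ho⟩ := h1
    exact ⟨o, lt_of_le_of_ne (h0 o) (Ne.symm ho)⟩
  · intro j hj i hij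
    refine lt_of_le_of_ne (h0 i) fun h => ?_
    have h2 := (mul_le_mulVec hT.nonneg h0 i j).trans (hr i)
    rw [← h, mul_zero] at h2
    exact absurd (mul_pos hij hj) (not_lt.2 h2)

theorem pos_of_mem_stdSimplex (hT : T.IsIrreducible) {h : Fin m → ℝ} {r : ℝ}
    (h0 : h ∈ stdSimplex ℝ (Fin m)) (hr : ∀ i, (T *ᵥ h) i ≤ r * h i) (i : Fin m) : 0 < h i := by
  refine pos_of_mulVec_le hT h0.1 ?_ hr i
  by_contra! h
  have := h0.2
  simp [h] at this

/-- Comparison of an eigenvalue with a superharmonic bound. -/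
theorem eigenvalue_le [NeZero m] (hT : ∀ i j, 0 ≤ T i j) {h k : Fin m → ℝ} {r s : ℝ}
    (hh : ∀ i, 0 < h i) (hk : ∀ i, 0 < k i) (hr : ∀ i, r * h i ≤ (T *ᵥ h) i)
    (hs : ∀ i, (T *ᵥ k) i ≤ s * k i) : r ≤ s := by
  obtain ⟨o, ho⟩ := Finite.exists_max fun i => h i / k i
  set t := h o / k o with ht
  have htk : ∀ i, h i ≤ (t • k) i := fun i => (div_le_iff₀ (hk i)).1 (ho i)
  have hto : t * k o = h o := div_mul_cancel₀ _ (hk o).ne'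
  have h1 : r * h o ≤ s * h o := by
    calc r * h o ≤ (T *ᵥ h) o := hr o
      _ ≤ (T *ᵥ (t • k)) o := mulVec_mono hT htk o
      _ = t * (T *ᵥ k) o := by rw [Matrix.mulVec_smul]; rfl
      _ ≤ t * (s * k o) := mul_le_mul_of_nonneg_left (hs o) (div_pos (hh o) (hk o)).le
      _ = s * h o := by rw [← hto]; ring
  exact le_of_mul_le_mul_right h1 (hh o)

/-- The Perron-Frobenius theorem: existence of a positive eigenvector. -/
theorem exists_pos_eigenvector [NeZero m] (hT : T.IsIrreducible) :
    ∃ (r : ℝ) (h : Fin m → ℝ), (∀ i, 0 < h i) ∧ ∑ i, h i = 1 ∧ T *ᵥ h = r • h := by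
  obtain ⟨R, hR0, hR⟩ : ∃ R : ℝ, 0 ≤ R ∧ ∀ i, ∑ j, T i j ≤ R := by
    refine ⟨∑ i, ∑ j, T i j, Finset.sum_nonneg fun i _ => Finset.sum_nonneg fun j _ =>
      hT.nonneg i j, fun i => Finset.single_le_sum (f := fun i => ∑ j, T i j)
        (fun i _ => Finset.sum_nonneg fun j _ => hT.nonneg i j) (Finset.mem_univ i)⟩
  -- The eigenvalue is the least `r` with `T h ≤ r h` for some `h` in the simplex. Bounding `r` by
  -- `R` makes the set compact, and the constant vector with `r = R` belongs to it.
  let S : Set (ℝ × (Fin m → ℝ)) :=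
    (Set.Icc 0 R ×ˢ stdSimplex ℝ (Fin m)) ∩ {p | ∀ i, (T *ᵥ p.2) i ≤ p.1 * p.2 i}
  have hS : IsCompact S := by
    refine (isCompact_Icc.prod (isCompact_stdSimplex (𝕜 := ℝ) (Fin m))).inter_right ?_
    simp only [Set.ofPred_forall]
    refine isClosed_iInter fun i => isClosed_le ?_ (by fun_prop)
    exact (continuous_apply i).comp (Continuous.matrix_mulVec continuous_const continuous_snd)
  have hSne : S.Nonempty := by
    have hm : (m : ℝ) ≠ 0 := Nat.cast_ne_zero.2 (NeZero.ne m)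
    refine ⟨(R, fun _ => (m : ℝ)⁻¹), ⟨⟨hR0, le_rfl⟩, fun _ => by positivity, by simp [hm]⟩,
      fun i => ?_⟩
    simp only [Matrix.mulVec, dotProduct, ← Finset.sum_mul]
    exact mul_le_mul_of_nonneg_right (hR i) (by positivity)
  obtain ⟨⟨r, h⟩, ⟨⟨hr, hh⟩, hle⟩, hmin⟩ := hS.exists_isMinOn hSne continuous_fst.continuousOn
  simp only [Set.mem_ofPred_eq] at hle
  have hpos := pos_of_mem_stdSimplex hT hh hle
  refine ⟨r, h, hpos, hh.2, ?_⟩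
  by_contra hne
  have hr0 : 0 ≤ r := hr.1
  -- If the defect `w` is nonzero, a finite sum `P` of powers of `T` makes it positive everywhere.
  -- As `P` commutes with `T`, the vector `P h` satisfies the inequality strictly, so `r` was not
  -- minimal.
  let w : Fin m → ℝ := r • h - T *ᵥ h
  have hw0 : ∀ i, 0 ≤ w i := fun i => sub_nonneg.2 (hle i)
  obtain ⟨o, ho⟩ : ∃ o, w o ≠ 0 := by
    by_contra! hw
    exact hne (funext fun i => (sub_eq_zero.1 (hw i)).symm)
  let v : ℕ → Fin m → ℝ := fun n => (T ^ n) *ᵥ w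
  have hTn : ∀ n i j, 0 ≤ (T ^ n) i j := fun n i j => Matrix.pow_apply_nonneg hT.nonneg n i j
  have hv0 : ∀ n i, 0 ≤ v n i := fun n i => mulVec_nonneg (hTn n) hw0 i
  have hvpos : ∀ i, ∃ n, 0 < v n i := by
    refine hT.mem_of_pred_closed (s := {i | ∃ n, 0 < v n i})
      ⟨o, 0, by simpa [v] using lt_of_le_of_ne (hw0 o) (Ne.symm ho)⟩ ?_
    rintro j ⟨n, hn⟩ i hij
    refine ⟨n + 1, (mul_pos hij hn).trans_le ?_⟩
    have : v (n + 1) = T *ᵥ v n := by simp only [v, pow_succ', Matrix.mulVec_mulVec]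
    rw [this]
    exact mul_le_mulVec hT.nonneg (hv0 n) i j
  choose N hN using hvpos
  -- The range reaches every `N i`, and always contains `0`, so that `P` dominates the identity and
  -- `P h` is positive.
  let M := Finset.univ.sup N + 1
  let P : Matrix (Fin m) (Fin m) ℝ := ∑ n ∈ Finset.range M, T ^ n
  have hP0 : ∀ i j, 0 ≤ P i j := fun i j => by
    simp only [P, Matrix.sum_apply]
    exact Finset.sum_nonneg fun n _ => hTn n i j
  have hPw : ∀ i, 0 < (P *ᵥ w) i := fun i => by
    simp only [P, Matrix.sum_mulVec, Finset.sum_apply]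
    exact (hN i).trans_le (Finset.single_le_sum (f := fun n => v n i) (fun n _ => hv0 n i)
      (Finset.mem_range.2 (Nat.lt_succ_of_le (Finset.le_sup (Finset.mem_univ i)))))
  let g := P *ᵥ h
  have hg : r • g - T *ᵥ g = P *ᵥ w := by
    have hc : Commute T P := Commute.sum_right _ _ _ fun n _ => Commute.self_pow T n
    simp only [g, w, Matrix.mulVec_sub, Matrix.mulVec_smul, Matrix.mulVec_mulVec, hc.eq]
  have hgpos : ∀ i, 0 < g i := fun i => by
    have h1 : (1 : Matrix (Fin m) (Fin m) ℝ) i i * h i ≤ P i i * h i := by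
      refine mul_le_mul_of_nonneg_right ?_ (hpos i).le
      simp only [P, Matrix.sum_apply]
      have := Finset.single_le_sum (f := fun n => (T ^ n) i i) (fun n _ => hTn n i i)
        (Finset.mem_range.2 (Nat.succ_pos _ : 0 < M))
      simpa using this
    have h2 := mul_le_mulVec hP0 (fun i => (hpos i).le) i i
    simp only [Matrix.one_apply_eq, one_mul] at h1
    exact (hpos i).trans_le (h1.trans h2)
  have hlt : ∀ i, (T *ᵥ g) i / g i < r := fun i => by
    rw [div_lt_iff₀ (hgpos i)]
    have := hPw i
    rw [← hg] at this
    simpa using this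
  obtain ⟨q, hq⟩ := Finite.exists_max fun i => (T *ᵥ g) i / g i
  set s := (T *ᵥ g) q / g q with hs
  have hs0 : 0 ≤ s := div_nonneg (mulVec_nonneg hT.nonneg (fun j => (hgpos j).le) q) (hgpos q).le
  have hsum : 0 < ∑ i, g i := Finset.sum_pos (fun i _ => hgpos i) Finset.univ_nonempty
  have hmem : ((s, (∑ i, g i)⁻¹ • g) : ℝ × (Fin m → ℝ)) ∈ S := by
    refine ⟨⟨⟨hs0, (hlt q).le.trans hr.2⟩, fun i => ?_, ?_⟩, fun i => ?_⟩
    · exact mul_nonneg (inv_nonneg.2 hsum.le) (hgpos i).le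
    · simp [← Finset.mul_sum, hsum.ne']
    · simp only [Matrix.mulVec_smul, Pi.smul_apply, smul_eq_mul]
      rw [mul_left_comm]
      exact mul_le_mul_of_nonneg_left ((div_le_iff₀ (hgpos i)).1 (hq i)) (inv_nonneg.2 hsum.le)
  exact absurd (hmin hmem) (not_le.2 (hlt q))

/-- An eigenvalue with a positive eigenvector is the Perron-Frobenius eigenvalue. -/
theorem pfEigenvalue_eq [NeZero m] (hT : ∀ i j, 0 ≤ T i j) {h : Fin m → ℝ} {r : ℝ}
    (hh : ∀ i, 0 < h i) (hr : T *ᵥ h = r • h) : pfEigenvalue T = r := by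
  let Tc : Matrix (Fin m) (Fin m) ℂ := T.map (algebraMap ℝ ℂ)
  have hri : ∀ i, (T *ᵥ h) i = r * h i := fun i => by rw [hr]; rfl
  have hr0 : 0 ≤ r := by
    have h1 : 0 ≤ (T *ᵥ h) 0 := mulVec_nonneg hT (fun j => (hh j).le) 0
    rw [hri] at h1
    exact nonneg_of_mul_nonneg_left h1 (hh 0)
  have hmem : (r : ℂ) ∈ spectrum ℂ Tc := by
    rw [← Matrix.spectrum_toLin', ← Module.End.hasEigenvalue_iff_mem_spectrum]
    refine Module.End.hasEigenvalue_of_hasEigenvector (x := fun i => (h i : ℂ)) ⟨?_, ?_⟩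
    · rw [Module.End.mem_eigenspace_iff]
      ext i
      have := congrArg (algebraMap ℝ ℂ) (hri i)
      simpa [Tc, Matrix.mulVec, dotProduct] using this
    · intro h0
      have := congrFun h0 0
      simp [(hh 0).ne'] at this
  -- For a complex eigenvector `x`, one has `‖z‖ ‖x‖ ≤ T ‖x‖` entrywise; evaluate this where `‖x i‖
  -- / h i` is largest.
  have hle : ∀ z ∈ spectrum ℂ Tc, ‖z‖ ≤ r := fun z hz => by
    rw [← Matrix.spectrum_toLin', ← Module.End.hasEigenvalue_iff_mem_spectrum] at hz
    obtain ⟨x, hx⟩ := hz.exists_hasEigenvector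
    have hxz : ∀ i, ∑ j, (T i j : ℂ) * x j = z * x i := fun i => by
      have := congrFun hx.apply_eq_smul i
      simpa [Tc, Matrix.mulVec, dotProduct] using this
    have hsub : ∀ i, ‖z‖ * ‖x i‖ ≤ ∑ j, T i j * ‖x j‖ := fun i => by
      rw [← norm_mul, ← hxz]
      refine (norm_sum_le _ _).trans (Finset.sum_le_sum fun j _ => ?_)
      rw [norm_mul, Complex.norm_real, Real.norm_of_nonneg (hT i j)]
    obtain ⟨o, ho⟩ := Finite.exists_max fun i => ‖x i‖ / h i
    set t := ‖x o‖ / h o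
    have hto : t * h o = ‖x o‖ := div_mul_cancel₀ _ (hh o).ne'
    have hxo : 0 < ‖x o‖ := by
      refine norm_pos_iff.2 fun h0 => hx.2 (funext fun i => ?_)
      have h1 := ho i
      simp only [t, h0, norm_zero, zero_div] at h1
      have h2 := (div_le_iff₀ (hh i)).1 h1
      rw [zero_mul] at h2
      exact norm_le_zero_iff.1 h2
    have h1 : ‖z‖ * ‖x o‖ ≤ r * ‖x o‖ := by
      calc ‖z‖ * ‖x o‖ ≤ ∑ j, T o j * ‖x j‖ := hsub o
        _ ≤ ∑ j, T o j * (t * h j) := Finset.sum_le_sum fun j _ =>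
            mul_le_mul_of_nonneg_left ((div_le_iff₀ (hh j)).1 (ho j)) (hT o j)
        _ = t * (T *ᵥ h) o := by
            simp only [Matrix.mulVec, dotProduct, Finset.mul_sum]
            exact Finset.sum_congr rfl fun j _ => by ring
        _ = r * ‖x o‖ := by rw [hri, ← hto]; ring
    exact le_of_mul_le_mul_right h1 hxo
  have hsr : spectralRadius ℂ Tc = ENNReal.ofReal r := by
    refine le_antisymm (iSup₂_le fun z hz => ?_) ?_
    · rw [← ENNReal.ofReal_coe_nnreal, coe_nnnorm]
      exact ENNReal.ofReal_le_ofReal (hle z hz)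
    · refine le_trans ?_ (le_iSup₂ (f := fun (k : ℂ) (_ : k ∈ spectrum ℂ Tc) => (‖k‖₊ : ℝ≥0∞))
        (r : ℂ) hmem)
      rw [← ENNReal.ofReal_coe_nnreal, coe_nnnorm]
      simp [abs_of_nonneg hr0]
  rw [pfEigenvalue, show T.map (algebraMap ℝ ℂ) = Tc from rfl, hsr, ENNReal.toReal_ofReal hr0]

end PerronFrobenius

/-! ### Vectors in `[0, ∞]` and Neumann series -/

/-- The entries of a real vector, seen in `[0, ∞]`. -/
def vecENN {n : ℕ} (v : Fin n → ℝ) : Fin n → ℝ≥0∞ := fun i => ENNReal.ofReal (v i)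

theorem toENN_mulVec {k n : ℕ} {T : Matrix (Fin k) (Fin n) ℝ} (hT : ∀ i j, 0 ≤ T i j)
    {v : Fin n → ℝ} (hv : ∀ i, 0 ≤ v i) : toENN T *ᵥ vecENN v = vecENN (T *ᵥ v) := by
  ext i
  simp only [Matrix.mulVec, dotProduct, toENN, vecENN, Matrix.map_apply]
  rw [ENNReal.ofReal_sum_of_nonneg fun j _ => mul_nonneg (hT i j) (hv j)]
  exact Finset.sum_congr rfl fun j _ => (ENNReal.ofReal_mul (hT i j)).symm

theorem vecENN_smul {n : ℕ} {c : ℝ} (hc : 0 ≤ c) (v : Fin n → ℝ) :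
    vecENN (c • v) = ENNReal.ofReal c • vecENN v := by
  ext i
  simp [vecENN, ENNReal.ofReal_mul hc]

theorem mulVec_mono_ennreal {k n : ℕ} (T : Matrix (Fin k) (Fin n) ℝ≥0∞) {v w : Fin n → ℝ≥0∞}
    (h : ∀ i, v i ≤ w i) (i : Fin k) : (T *ᵥ v) i ≤ (T *ᵥ w) i := by
  simp only [Matrix.mulVec, dotProduct]
  exact Finset.sum_le_sum fun j _ => mul_le_mul_right (h j) _

section Neumann

variable {n : ℕ} (S : Matrix (Fin n) (Fin n) ℝ≥0∞)

theorem npow_eq_pow (k : ℕ) : npow S k = S ^ k := by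
  induction k with
  | zero => simp [npow]
  | succ k ih =>
    ext i j
    simp [npow, ih, pow_succ', Matrix.mul_apply, tsum_fintype]

theorem neumann_mulVec (v : Fin n → ℝ≥0∞) (i : Fin n) :
    (neumann S *ᵥ v) i = ∑' k, ((S ^ k) *ᵥ v) i := by
  simp only [Matrix.mulVec, dotProduct, neumann, npow_eq_pow, ← ENNReal.tsum_mul_right]
  exact (Summable.tsum_finsetSum fun _ _ => ENNReal.summable).symm

theorem neumann_mulVec_eq (v : Fin n → ℝ≥0∞) :
    neumann S *ᵥ v = v + S *ᵥ (neumann S *ᵥ v) := by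
  ext i
  rw [neumann_mulVec, tsum_eq_zero_add' ENNReal.summable]
  simp only [pow_zero, Matrix.one_mulVec, Pi.add_apply, pow_succ']
  congr 1
  conv_rhs => rw [Matrix.mulVec, dotProduct]
  simp only [neumann_mulVec, ← ENNReal.tsum_mul_left, ← Matrix.mulVec_mulVec]
  rw [← Summable.tsum_finsetSum fun _ _ => ENNReal.summable]
  rfl

/-- The Neumann series is the least solution of `v + S z ≤ z`: each partial sum is obtained from the
previous one by the monotone map `z ↦ v + S z`, starting from `0`. -/
theorem neumann_mulVec_le {v z : Fin n → ℝ≥0∞} (h : ∀ i, v i + (S *ᵥ z) i ≤ z i) (i : Fin n) :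
    (neumann S *ᵥ v) i ≤ z i := by
  rw [neumann_mulVec]
  refine ENNReal.tsum_le_of_sum_range_le fun k => ?_
  induction k generalizing i with
  | zero => simp
  | succ k ih =>
    rw [Finset.sum_range_succ']
    simp only [pow_zero, Matrix.one_mulVec, pow_succ', ← Matrix.mulVec_mulVec]
    rw [add_comm]
    refine le_trans ?_ (h i)
    gcongr
    rw [← Finset.sum_apply, ← Matrix.mulVec_sum]
    refine mulVec_mono_ennreal S (fun j => ?_) i
    rw [Finset.sum_apply]
    exact ih j

end Neumann

/-! ### Rows of `K`, exponential vectors and elimination of block `0` -/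

namespace Blocks

variable {m₀ m : ℕ} (D : Blocks m₀ m)

section Rows

variable (y : Index m₀ m → ℝ≥0∞)

theorem tsum_index (f : Index m₀ m → ℝ≥0∞) :
    ∑' x, f x = ∑ j, f (.inl j) + ∑' n, ∑ j, f (.inr (n, j)) := by
  rw [Summable.tsum_sum ENNReal.summable ENNReal.summable, tsum_fintype,
    ENNReal.tsum_prod' (f := fun p => f (.inr p))]
  simp only [tsum_fintype]

theorem tsum_K_inl (i : Fin m₀) :
    ∑' x, ENNReal.ofReal (D.K (.inl i) x) * y x =
      (toENN D.B0 *ᵥ fun j => y (.inl j)) i + (toENN D.B1 *ᵥ fun j => y (.inr (0, j))) i := by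
  rw [tsum_index, tsum_eq_single 0 (fun n hn => by simp [K, hn])]
  simp [K, Matrix.mulVec, dotProduct, toENN]

theorem tsum_K_inr_zero (i : Fin m) :
    ∑' x, ENNReal.ofReal (D.K (.inr (0, i)) x) * y x =
      (toENN D.Bm *ᵥ fun j => y (.inl j)) i + ((toENN D.A0 *ᵥ fun j => y (.inr (0, j))) i +
        (toENN D.A1 *ᵥ fun j => y (.inr (1, j))) i) := by
  rw [tsum_index, tsum_eq_sum (s := {0, 1}) (fun n hn => ?_), Finset.sum_pair (by simp)]
  · simp [K, Matrix.mulVec, dotProduct, toENN]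
  · simp only [Finset.mem_insert, Finset.mem_singleton, not_or] at hn
    simp [K, hn]

theorem tsum_K_inr_succ (n : ℕ) (i : Fin m) :
    ∑' x, ENNReal.ofReal (D.K (.inr (n + 1, i)) x) * y x =
      (toENN D.Am *ᵥ fun j => y (.inr (n, j))) i + ((toENN D.A0 *ᵥ fun j => y (.inr (n + 1, j))) i +
        (toENN D.A1 *ᵥ fun j => y (.inr (n + 2, j))) i) := by
  rw [tsum_index, tsum_eq_sum (s := {n, n + 1, n + 2}) (fun l hl => ?_),
    Finset.sum_insert (by simp), Finset.sum_pair (by simp)]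
  · have h1 : ¬ n = n + 1 + 1 := by lia
    simp [K, h1, Matrix.mulVec, dotProduct, toENN]
  · simp only [Finset.mem_insert, Finset.mem_singleton, not_or] at hl
    have h2 : ¬ n = l := fun h => hl.1 h.symm
    simp [K, hl, h2]

end Rows

/-- The inequalities of a superharmonic vector on the levels above the first one. -/
structure IsInterior (y : ℕ → Fin m → ℝ) : Prop where
  pos : ∀ n i, 0 < y n i
  le : ∀ n i, (D.Am *ᵥ y n) i + (D.A0 *ᵥ y (n + 1)) i + (D.A1 *ᵥ y (n + 2)) i ≤ y (n + 1) i

theorem tsum_K_le_iff {y₀ : Fin m₀ → ℝ} {y : ℕ → Fin m → ℝ} (hn₀ : ∀ i, 0 ≤ y₀ i)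
    (hn : ∀ n i, 0 ≤ y n i) :
    (∀ x, ∑' x', ENNReal.ofReal (D.K x x') *
      ENNReal.ofReal (Sum.elim y₀ (fun p => y p.1 p.2) x') ≤
        ENNReal.ofReal (Sum.elim y₀ (fun p => y p.1 p.2) x)) ↔
      (∀ i, (D.B0 *ᵥ y₀) i + (D.B1 *ᵥ y 0) i ≤ y₀ i) ∧
      (∀ i, (D.Bm *ᵥ y₀) i + (D.A0 *ᵥ y 0) i + (D.A1 *ᵥ y 1) i ≤ y 0 i) ∧
      ∀ n i, (D.Am *ᵥ y n) i + (D.A0 *ᵥ y (n + 1)) i + (D.A1 *ᵥ y (n + 2)) i ≤ y (n + 1) i := by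
  have e0 : ∀ i, (∑' x, ENNReal.ofReal (D.K (.inl i) x) *
      ENNReal.ofReal (Sum.elim y₀ (fun p => y p.1 p.2) x) ≤ ENNReal.ofReal (y₀ i)) ↔
      (D.B0 *ᵥ y₀) i + (D.B1 *ᵥ y 0) i ≤ y₀ i := fun i => by
    rw [tsum_K_inl]
    change (toENN D.B0 *ᵥ vecENN y₀) i + (toENN D.B1 *ᵥ vecENN (y 0)) i ≤ _ ↔ _
    rw [toENN_mulVec D.B0_nonneg hn₀, toENN_mulVec D.B1_nonneg (hn 0), vecENN, vecENN,
      ← ENNReal.ofReal_add (mulVec_nonneg D.B0_nonneg hn₀ i) (mulVec_nonneg D.B1_nonneg (hn 0) i),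
      ENNReal.ofReal_le_ofReal_iff (hn₀ i)]
  have e1 : ∀ i, (∑' x, ENNReal.ofReal (D.K (.inr (0, i)) x) *
      ENNReal.ofReal (Sum.elim y₀ (fun p => y p.1 p.2) x) ≤ ENNReal.ofReal (y 0 i)) ↔
      (D.Bm *ᵥ y₀) i + (D.A0 *ᵥ y 0) i + (D.A1 *ᵥ y 1) i ≤ y 0 i := fun i => by
    have a1 := mulVec_nonneg D.Bm_nonneg hn₀ i
    have a2 := mulVec_nonneg D.A0_nonneg (hn 0) i
    have a3 := mulVec_nonneg D.A1_nonneg (hn 1) i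
    rw [tsum_K_inr_zero]
    change (toENN D.Bm *ᵥ vecENN y₀) i + ((toENN D.A0 *ᵥ vecENN (y 0)) i +
      (toENN D.A1 *ᵥ vecENN (y 1)) i) ≤ _ ↔ _
    rw [toENN_mulVec D.Bm_nonneg hn₀, toENN_mulVec D.A0_nonneg (hn 0),
      toENN_mulVec D.A1_nonneg (hn 1), vecENN, vecENN, vecENN, ← ENNReal.ofReal_add a2 a3,
      ← ENNReal.ofReal_add a1 (add_nonneg a2 a3), ENNReal.ofReal_le_ofReal_iff (hn 0 i), add_assoc]
  have e2 : ∀ n i, (∑' x, ENNReal.ofReal (D.K (.inr (n + 1, i)) x) *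
      ENNReal.ofReal (Sum.elim y₀ (fun p => y p.1 p.2) x) ≤ ENNReal.ofReal (y (n + 1) i)) ↔
      (D.Am *ᵥ y n) i + (D.A0 *ᵥ y (n + 1)) i + (D.A1 *ᵥ y (n + 2)) i ≤ y (n + 1) i :=
      fun n i => by
    have a1 := mulVec_nonneg D.Am_nonneg (hn n) i
    have a2 := mulVec_nonneg D.A0_nonneg (hn (n + 1)) i
    have a3 := mulVec_nonneg D.A1_nonneg (hn (n + 2)) i
    rw [tsum_K_inr_succ]
    change (toENN D.Am *ᵥ vecENN (y n)) i + ((toENN D.A0 *ᵥ vecENN (y (n + 1))) i +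
      (toENN D.A1 *ᵥ vecENN (y (n + 2))) i) ≤ _ ↔ _
    rw [toENN_mulVec D.Am_nonneg (hn n), toENN_mulVec D.A0_nonneg (hn (n + 1)),
      toENN_mulVec D.A1_nonneg (hn (n + 2)), vecENN, vecENN, vecENN, ← ENNReal.ofReal_add a2 a3,
      ← ENNReal.ofReal_add a1 (add_nonneg a2 a3), ENNReal.ofReal_le_ofReal_iff (hn (n + 1) i),
      add_assoc]
  constructor
  · intro h
    exact ⟨fun i => (e0 i).1 (h (.inl i)), fun i => (e1 i).1 (h (.inr (0, i))),
      fun n i => (e2 n i).1 (h (.inr (n + 1, i)))⟩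
  · rintro ⟨h0, h1, h2⟩ (i | ⟨_ | n, i⟩)
    exacts [(e0 i).2 (h0 i), (e1 i).2 (h1 i), (e2 n i).2 (h2 n i)]

theorem Astar_mulVec (θ : ℝ) (v : Fin m → ℝ) (i : Fin m) : (D.Astar θ *ᵥ v) i =
    Real.exp (-θ) * (D.Am *ᵥ v) i + (D.A0 *ᵥ v) i + Real.exp θ * (D.A1 *ᵥ v) i := by
  simp [Astar, Matrix.add_mulVec, Matrix.smul_mulVec]

theorem Astar_nonneg (θ : ℝ) (i j : Fin m) : 0 ≤ D.Astar θ i j := by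
  have h1 := D.Am_nonneg i j
  have h2 := D.A0_nonneg i j
  have h3 := D.A1_nonneg i j
  simp only [Astar, Matrix.add_apply, Matrix.smul_apply, smul_eq_mul]
  positivity

theorem Astar_pos_iff (θ : ℝ) (i j : Fin m) :
    0 < D.Astar θ i j ↔ 0 < D.Am i j ∨ 0 < D.A0 i j ∨ 0 < D.A1 i j := by
  have h1 := D.Am_nonneg i j
  have h2 := D.A0_nonneg i j
  have h3 := D.A1_nonneg i j
  simp only [Astar, Matrix.add_apply, Matrix.smul_apply, smul_eq_mul]
  constructor
  · intro h
    by_contra! h'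
    rw [le_antisymm h'.1 h1, le_antisymm h'.2.1 h2, le_antisymm h'.2.2 h3] at h
    simp at h
  · rintro (h | h | h) <;> positivity

theorem _root_.Matrix.IsIrreducible.of_pos_imp {ι : Type*} {S T : Matrix ι ι ℝ}
    (hS : S.IsIrreducible) (hT : ∀ i j, 0 ≤ T i j) (h : ∀ i j, 0 < S i j → 0 < T i j) :
    T.IsIrreducible := by
  refine ⟨hT, fun i j => ?_⟩
  have key : ∀ {k : ι} (p : @Quiver.Path ι S.toQuiver i k),
      ∃ q : @Quiver.Path ι T.toQuiver i k,
        @Quiver.Path.length ι T.toQuiver _ _ q = @Quiver.Path.length ι S.toQuiver _ _ p := by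
    intro k p
    induction p with
    | nil => exact ⟨@Quiver.Path.nil ι T.toQuiver i, rfl⟩
    | cons p e ih =>
      obtain ⟨q, hq⟩ := ih
      exact ⟨@Quiver.Path.cons ι T.toQuiver _ _ _ q ⟨h _ _ e.down⟩, congrArg (· + 1) hq⟩
  obtain ⟨p, hp⟩ := hS.connected i j
  obtain ⟨q, hq⟩ := key p
  exact ⟨q, hq ▸ hp⟩

variable {D}

theorem Astar_isIrreducible (hA : (D.Astar 0).IsIrreducible) (θ : ℝ) :
    (D.Astar θ).IsIrreducible :=
  hA.of_pos_imp (D.Astar_nonneg θ) fun i j h => (D.Astar_pos_iff θ i j).2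
    ((D.Astar_pos_iff 0 i j).1 h)

/-- The identity behind exponential solutions of the interior equations. -/
theorem interior_exp (θ : ℝ) (h : Fin m → ℝ) (n : ℕ) (i : Fin m) :
    (D.Am *ᵥ (Real.exp (n * θ) • h)) i + (D.A0 *ᵥ (Real.exp ((n + 1 : ℕ) * θ) • h)) i +
      (D.A1 *ᵥ (Real.exp ((n + 2 : ℕ) * θ) • h)) i =
    Real.exp ((n + 1 : ℕ) * θ) * (D.Astar θ *ᵥ h) i := by
  have e1 : Real.exp (n * θ) = Real.exp ((n + 1 : ℕ) * θ) * Real.exp (-θ) := by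
    rw [← Real.exp_add]
    push_cast
    ring_nf
  have e2 : Real.exp ((n + 2 : ℕ) * θ) = Real.exp ((n + 1 : ℕ) * θ) * Real.exp θ := by
    rw [← Real.exp_add]
    push_cast
    ring_nf
  rw [Astar_mulVec, e1, e2]
  simp only [Matrix.mulVec_smul, Pi.smul_apply, smul_eq_mul]
  ring

theorem isInterior_exp {θ : ℝ} {h : Fin m → ℝ} (hh : ∀ i, 0 < h i)
    (hθ : ∀ i, (D.Astar θ *ᵥ h) i ≤ h i) : D.IsInterior fun n => Real.exp (n * θ) • h where
  pos n i := mul_pos (Real.exp_pos _) (hh i)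
  le n i := by
    rw [interior_exp]
    exact mul_le_mul_of_nonneg_left (hθ i) (Real.exp_pos _).le

theorem IsInterior.smul {y : ℕ → Fin m → ℝ} (hy : D.IsInterior y) {c : ℝ} (hc : 0 < c) :
    D.IsInterior (c • y) where
  pos n i := mul_pos hc (hy.pos n i)
  le n i := by
    simp only [Pi.smul_apply, Matrix.mulVec_smul, smul_eq_mul, ← mul_add]
    exact mul_le_mul_of_nonneg_left (hy.le n i) hc.le

theorem IsInterior.shift {y : ℕ → Fin m → ℝ} (hy : D.IsInterior y) (k : ℕ) :
    D.IsInterior fun n => y (n + k) where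
  pos n i := hy.pos _ i
  le n i := by
    have := hy.le (n + k) i
    rwa [show n + k + 1 = n + 1 + k by ring, show n + k + 2 = n + 2 + k by ring] at this

theorem Cstar_mulVec (θ : ℝ) (v : Fin m → ℝ≥0∞) (i : Fin m) :
    (D.Cstar θ *ᵥ v) i = (toENN D.Bm *ᵥ (neumann (toENN D.B0) *ᵥ (toENN D.B1 *ᵥ v))) i +
      (toENN D.A0 *ᵥ v) i + ENNReal.ofReal (Real.exp θ) * (toENN D.A1 *ᵥ v) i := by
  have : toENN (Real.exp θ • D.A1) = ENNReal.ofReal (Real.exp θ) • toENN D.A1 := by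
    ext i j
    simp [toENN, ENNReal.ofReal_mul (Real.exp_pos θ).le]
  rw [Cstar, C0, this]
  simp [Matrix.add_mulVec, Matrix.smul_mulVec, Matrix.mulVec_mulVec, Matrix.mul_assoc]

/-- The fixed-point equation of the Neumann series settles block row `0`, the bound on `C_*(θ)` the
next row, and the bound on `A_*(θ)` all others. The block `z` might have zero or infinite entries a
priori; irreducibility of `K` rules this out. -/
theorem exists_isSuperharmonic_of_GammaD_nonempty (hm : 0 < m) (hK : D.K.IsIrreducible)
    (hΓ : D.GammaD.Nonempty) : ∃ y, IsSuperharmonic D.K y := by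
  obtain ⟨θ, h, hh, hAh, hCh⟩ := hΓ
  have hn : ∀ i, 0 ≤ h i := fun i => (hh i).le
  let y : ℕ → Fin m → ℝ := fun n => Real.exp ((n + 1 : ℕ) * θ) • h
  have hy : D.IsInterior y := (isInterior_exp hh hAh).shift 1
  have hyn : ∀ n i, 0 ≤ y n i := fun n i => (hy.pos n i).le
  have hy0 : vecENN (y 0) = ENNReal.ofReal (Real.exp θ) • vecENN h := by
    simp only [y]
    rw [vecENN_smul (Real.exp_pos _).le]
    simp
  have hy1 : vecENN (y 1) =
      ENNReal.ofReal (Real.exp θ) • ENNReal.ofReal (Real.exp θ) • vecENN h := by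
    simp only [y]
    rw [vecENN_smul (Real.exp_pos _).le, smul_smul, ← ENNReal.ofReal_mul (Real.exp_pos _).le,
      ← Real.exp_add]
    congr 3
    push_cast
    ring
  let z : Fin m₀ → ℝ≥0∞ := neumann (toENN D.B0) *ᵥ (toENN D.B1 *ᵥ vecENN (y 0))
  let Y : Index m₀ m → ℝ≥0∞ := Sum.elim z fun p => vecENN (y p.1) p.2
  let o : Fin m := ⟨0, hm⟩
  refine ⟨_, (exists_isSuperharmonic hK Y (.inr (0, o)) ?_ ?_ ?_).2.2⟩
  · simpa [Y, vecENN] using hy.pos 0 o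
  · simp [Y, vecENN]
  · rintro (i | ⟨_ | n, i⟩)
    · rw [tsum_K_inl]
      change (toENN D.B0 *ᵥ z) i + (toENN D.B1 *ᵥ vecENN (y 0)) i ≤ z i
      rw [add_comm]
      exact (congrFun (neumann_mulVec_eq _ _) i).ge
    · rw [tsum_K_inr_zero]
      change (toENN D.Bm *ᵥ z) i + ((toENN D.A0 *ᵥ vecENN (y 0)) i +
        (toENN D.A1 *ᵥ vecENN (y 1)) i) ≤ vecENN (y 0) i
      have h1 := hCh i
      rw [Cstar_mulVec] at h1
      change _ ≤ vecENN h i at h1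
      change (toENN D.Bm *ᵥ (neumann (toENN D.B0) *ᵥ (toENN D.B1 *ᵥ vecENN h))) i +
        (toENN D.A0 *ᵥ vecENN h) i + _ * (toENN D.A1 *ᵥ vecENN h) i ≤ _ at h1
      simp only [z, hy0, hy1, Matrix.mulVec_smul, Pi.smul_apply, smul_eq_mul]
      refine le_trans (le_of_eq ?_) (mul_le_mul_right h1 (ENNReal.ofReal (Real.exp θ)))
      ring
    · rw [tsum_K_inr_succ]
      change (toENN D.Am *ᵥ vecENN (y n)) i + ((toENN D.A0 *ᵥ vecENN (y (n + 1))) i +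
        (toENN D.A1 *ᵥ vecENN (y (n + 2))) i) ≤ vecENN (y (n + 1)) i
      have a1 := mulVec_nonneg D.Am_nonneg (hyn n) i
      have a2 := mulVec_nonneg D.A0_nonneg (hyn (n + 1)) i
      have a3 := mulVec_nonneg D.A1_nonneg (hyn (n + 2)) i
      rw [toENN_mulVec D.Am_nonneg (hyn n), toENN_mulVec D.A0_nonneg (hyn (n + 1)),
        toENN_mulVec D.A1_nonneg (hyn (n + 2)), vecENN, vecENN, vecENN,
        ← ENNReal.ofReal_add a2 a3, ← ENNReal.ofReal_add a1 (add_nonneg a2 a3), ← add_assoc]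
      exact ENNReal.ofReal_le_ofReal (hy.le n i)

/-- By minimality of the Neumann series, `(∑ B₀ ^ n) e^θ B₁ h ≤ h₀`. This bounds the term through
`B₋₁` by `e^{-θ} B₋₁ h₀`, finite even if the Neumann series has infinite entries. -/
theorem Cstar_mulVec_le {θ : ℝ} {h : Fin m → ℝ} {h₀ : Fin m₀ → ℝ} (hh : ∀ i, 0 < h i)
    (hh₀ : ∀ i, 0 < h₀ i) (h1 : ∀ i, (D.B0 *ᵥ h₀) i + Real.exp θ * (D.B1 *ᵥ h) i ≤ h₀ i)
    (h2 : ∀ i, Real.exp (-θ) * (D.Bm *ᵥ h₀) i + (D.A0 *ᵥ h) i + Real.exp θ * (D.A1 *ᵥ h) i ≤ h i)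
    (i : Fin m) : (D.Cstar θ *ᵥ fun j => ENNReal.ofReal (h j)) i ≤ ENNReal.ofReal (h i) := by
  have hn : ∀ i, 0 ≤ h i := fun i => (hh i).le
  have hn₀ : ∀ i, 0 ≤ h₀ i := fun i => (hh₀ i).le
  have hg : ∀ i, 0 ≤ (Real.exp θ • (D.B1 *ᵥ h)) i := fun i =>
    mul_nonneg (Real.exp_pos _).le (mulVec_nonneg D.B1_nonneg hn i)
  have key : ∀ i, (neumann (toENN D.B0) *ᵥ vecENN (Real.exp θ • (D.B1 *ᵥ h))) i ≤ vecENN h₀ i := by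
    refine neumann_mulVec_le _ fun i => ?_
    rw [toENN_mulVec D.B0_nonneg hn₀, vecENN, vecENN,
      ← ENNReal.ofReal_add (hg i) (mulVec_nonneg D.B0_nonneg hn₀ i), add_comm]
    exact ENNReal.ofReal_le_ofReal (h1 i)
  have e1 : toENN D.B1 *ᵥ vecENN h =
      ENNReal.ofReal (Real.exp (-θ)) • vecENN (Real.exp θ • (D.B1 *ᵥ h)) := by
    rw [toENN_mulVec D.B1_nonneg hn, ← vecENN_smul (Real.exp_pos _).le, smul_smul,
      ← Real.exp_add]
    simp
  have a1 := mulVec_nonneg D.Bm_nonneg hn₀ i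
  have a2 := mulVec_nonneg D.A0_nonneg hn i
  have a3 := mulVec_nonneg D.A1_nonneg hn i
  rw [Cstar_mulVec]
  change (toENN D.Bm *ᵥ (neumann (toENN D.B0) *ᵥ (toENN D.B1 *ᵥ vecENN h))) i +
    (toENN D.A0 *ᵥ vecENN h) i + _ * (toENN D.A1 *ᵥ vecENN h) i ≤ _
  rw [e1]
  simp only [Matrix.mulVec_smul, Pi.smul_apply, smul_eq_mul]
  calc _ ≤ ENNReal.ofReal (Real.exp (-θ)) * (toENN D.Bm *ᵥ vecENN h₀) i +
        (toENN D.A0 *ᵥ vecENN h) i + ENNReal.ofReal (Real.exp θ) * (toENN D.A1 *ᵥ vecENN h) i := by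
        gcongr
        exact mulVec_mono_ennreal _ key i
    _ = ENNReal.ofReal (Real.exp (-θ) * (D.Bm *ᵥ h₀) i + (D.A0 *ᵥ h) i +
          Real.exp θ * (D.A1 *ᵥ h) i) := by
        rw [toENN_mulVec D.Bm_nonneg hn₀, toENN_mulVec D.A0_nonneg hn,
          toENN_mulVec D.A1_nonneg hn, vecENN, vecENN, vecENN,
          ENNReal.ofReal_add (by positivity) (by positivity),
          ENNReal.ofReal_add (by positivity) (by positivity),
          ENNReal.ofReal_mul (Real.exp_pos _).le, ENNReal.ofReal_mul (Real.exp_pos _).le]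
    _ ≤ _ := ENNReal.ofReal_le_ofReal (h2 i)

end Blocks

/-! ### Existence of a critical parameter -/

/-- A positive sequence between two geometric sequences has a radius of convergence near which
a single term is negligible with respect to the tail it starts. -/
theorem exists_radius {t : ℕ → ℝ} {a b c C : ℝ} (ha : 0 < a) (hc : 0 < c)
    (hC : 0 < C) (hlow : ∀ n, a * c ^ n ≤ t n) (hup : ∀ n, t n ≤ b * C ^ n) :
    ∃ R, 0 < R ∧ ∀ ε, 0 < ε → ∃ x, 0 < x ∧ |x - R| < ε ∧ (Summable fun n => t n * x ^ n) ∧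
      ∃ M, t M * x ^ M ≤ ε * ∑' k, t (M + k) * x ^ (M + k) := by
  have ht : ∀ n, 0 < t n := fun n => (by positivity : 0 < a * c ^ n).trans_le (hlow n)
  let X : Set ℝ := {x | 0 < x ∧ Summable fun n => t n * x ^ n}
  have hbdd : BddAbove X := by
    refine ⟨c⁻¹, fun x ⟨hx, hs⟩ => ?_⟩
    by_contra! hlt
    have h1 : 1 ≤ c * x := ((inv_lt_iff_one_lt_mul₀' hc).1 hlt).le
    have h2 : ∀ n, a ≤ t n * x ^ n := fun n => by
      calc a ≤ a * (c * x) ^ n := le_mul_of_one_le_right ha.le (one_le_pow₀ h1)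
        _ = a * c ^ n * x ^ n := by rw [mul_pow, mul_assoc]
        _ ≤ t n * x ^ n := mul_le_mul_of_nonneg_right (hlow n) (by positivity)
    exact absurd (ge_of_tendsto' hs.tendsto_atTop_zero h2) (not_le.2 ha)
  have hne : (2 * C)⁻¹ ∈ X := by
    refine ⟨by positivity, Summable.of_nonneg_of_le (fun n => by have := ht n; positivity)
      (fun n => ?_) (summable_geometric_two.mul_left b)⟩
    calc t n * (2 * C)⁻¹ ^ n ≤ b * C ^ n * (2 * C)⁻¹ ^ n :=
          mul_le_mul_of_nonneg_right (hup n) (by positivity)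
      _ = b * (1 / 2) ^ n := by rw [mul_assoc, ← mul_pow]; congr 2; field_simp
  have hR : 0 < sSup X := hne.1.trans_le (le_csSup hbdd hne)
  refine ⟨sSup X, hR, fun ε hε => ?_⟩
  set R := sSup X
  set δ := min ε (1 / 2)
  have hδ0 : 0 < δ := lt_min hε (by norm_num)
  have hδ1 : δ ≤ 1 / 2 := min_le_right _ _
  have hδε : δ ≤ ε := min_le_left _ _
  obtain ⟨x, hxX, hx⟩ := exists_lt_of_lt_csSup ⟨_, hne⟩
    (max_lt (sub_lt_self R hε) (by nlinarith) : max (R - ε) (R * (1 - δ / 2)) < R)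
  have hxR : x ≤ R := le_csSup hbdd hxX
  refine ⟨x, hxX.1, ?_, hxX.2, ?_⟩
  · rw [abs_lt]
    constructor
    · linarith [le_max_left (R - ε) (R * (1 - δ / 2))]
    · linarith
  by_contra! hcon
  have hx0 := hxX.1
  have hsum : ∀ M, Summable fun k => t (M + k) * x ^ (M + k) := fun M => by
    simpa only [add_comm M] using (summable_nat_add_iff M).2 hxX.2
  let S : ℕ → ℝ := fun M => ∑' k, t (M + k) * x ^ (M + k)
  have hS0 : ∀ M, 0 ≤ S M := fun M => tsum_nonneg fun k => by have := ht (M + k); positivity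
  have hSs : ∀ M, S M = t M * x ^ M + S (M + 1) := fun M => by
    simp only [S]
    rw [(hsum M).tsum_eq_zero_add]
    simp only [add_zero, add_assoc, add_comm 1]
  -- If every term exceeds `ε` times its tail, the tails decay geometrically, so the series still
  -- converges beyond `R`.
  have hdec : ∀ M, S M ≤ (1 - δ) ^ M * S 0 := fun M => by
    induction M with
    | zero => simp
    | succ M ih =>
      have h1 : ε * S M < t M * x ^ M := hcon M
      have h2 : δ * S M ≤ ε * S M := mul_le_mul_of_nonneg_right hδε (hS0 M)
      calc S (M + 1) ≤ (1 - δ) * S M := by linarith [hSs M]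
        _ ≤ (1 - δ) * ((1 - δ) ^ M * S 0) := mul_le_mul_of_nonneg_left ih (by linarith)
        _ = _ := by ring
  -- Since `1 - δ < q`, the series converges at `x / q`; since `x > R q`, this point lies beyond
  -- `R`.
  set q := 1 - δ / 2
  have hq : 0 < q := by simp only [q]; linarith
  have hmem : x / q ∈ X := by
    refine ⟨by positivity, Summable.of_nonneg_of_le (fun n => by have := ht n; positivity)
      (fun n => ?_) ((summable_geometric_of_lt_one (r := (1 - δ) / q)
        (div_nonneg (by linarith) hq.le) ((div_lt_one hq).2 (by simp only [q]; linarith))).mul_left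
        (S 0))⟩
    calc t n * (x / q) ^ n = t n * x ^ n / q ^ n := by rw [div_pow, mul_div_assoc]
      _ ≤ (1 - δ) ^ n * S 0 / q ^ n := div_le_div_of_nonneg_right
          (by linarith [hSs n, hdec n, hS0 (n + 1)]) (pow_pos hq n).le
      _ = S 0 * ((1 - δ) / q) ^ n := by rw [div_pow]; ring
  have h1 : x / q ≤ R := le_csSup hbdd hmem
  rw [div_le_iff₀ hq] at h1
  linarith [le_max_right (R - ε) (R * q)]

namespace Blocks

variable {m₀ m : ℕ} {D : Blocks m₀ m}

namespace IsInterior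

variable {y : ℕ → Fin m → ℝ} (hy : D.IsInterior y)
include hy

theorem nonneg (n : ℕ) (i : Fin m) : 0 ≤ y n i := (hy.pos n i).le

theorem Am_mul_le (n : ℕ) (i j : Fin m) : D.Am i j * y n j ≤ y (n + 1) i := by
  have h1 := mul_le_mulVec D.Am_nonneg (hy.nonneg n) i j
  have h2 := mulVec_nonneg D.A0_nonneg (hy.nonneg (n + 1)) i
  have h3 := mulVec_nonneg D.A1_nonneg (hy.nonneg (n + 2)) i
  linarith [hy.le n i]

theorem A0_mul_le (n : ℕ) (i j : Fin m) : D.A0 i j * y (n + 1) j ≤ y (n + 1) i := by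
  have h1 := mulVec_nonneg D.Am_nonneg (hy.nonneg n) i
  have h2 := mul_le_mulVec D.A0_nonneg (hy.nonneg (n + 1)) i j
  have h3 := mulVec_nonneg D.A1_nonneg (hy.nonneg (n + 2)) i
  linarith [hy.le n i]

theorem A1_mul_le (n : ℕ) (i j : Fin m) : D.A1 i j * y (n + 2) j ≤ y (n + 1) i := by
  have h1 := mulVec_nonneg D.Am_nonneg (hy.nonneg n) i
  have h2 := mulVec_nonneg D.A0_nonneg (hy.nonneg (n + 1)) i
  have h3 := mul_le_mulVec D.A1_nonneg (hy.nonneg (n + 2)) i j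
  linarith [hy.le n i]

end IsInterior

theorem K_inr_inr_pos {k l : ℕ} {i j : Fin m} (h : 0 < D.K (.inr (k, i)) (.inr (l, j))) :
    (l = k + 1 ∧ 0 < D.A1 i j) ∨ (l = k ∧ 0 < D.A0 i j) ∨ (k = l + 1 ∧ 0 < D.Am i j) := by
  simp only [K] at h
  split_ifs at h with h1 h2 h3
  · exact Or.inl ⟨h1, h⟩
  · exact Or.inr (Or.inl ⟨h2, h⟩)
  · exact Or.inr (Or.inr ⟨h3, h⟩)
  · exact absurd h (lt_irrefl _)

/-- From every state there is a way down by one level which stays above the target level. -/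
theorem exists_down (hK : D.K.IsIrreducible) (i : Fin m) :
    ∃ j c, 0 < c ∧ ∀ y, D.IsInterior y → c * y 0 j ≤ y 1 i := by
  -- The condition is vacuous at the states `.inl` and `.inr (0, i)`, which makes `s` nonempty. The
  -- induction follows a path only up to its first visit to level `0`, so only interior rows are
  -- used.
  let s : Set (Index m₀ m) := {x | ∀ n i, x = .inr (n + 1, i) →
    ∃ j c, 0 < c ∧ ∀ y, D.IsInterior y → c * y 0 j ≤ y (n + 1) i}
  refine hK.mem_of_pred_closed (s := s) ⟨.inr (0, i), by simp [s]⟩ ?_ (.inr (1, i)) 0 i rfl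
  rintro x hx _ hpos n i rfl
  have step : ∀ {l : ℕ} {i' : Fin m} {a : ℝ}, x = .inr (l + 1, i') → 0 < a →
      (∀ y, D.IsInterior y → a * y (l + 1) i' ≤ y (n + 1) i) →
      ∃ j c, 0 < c ∧ ∀ y, D.IsInterior y → c * y 0 j ≤ y (n + 1) i := by
    intro l i' a hxl ha hle
    obtain ⟨j, c, hc, h⟩ := hx l i' hxl
    refine ⟨j, a * c, mul_pos ha hc, fun y hy => ?_⟩
    rw [mul_assoc]
    exact (mul_le_mul_of_nonneg_left (h y hy) ha.le).trans (hle y hy)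
  rcases x with x | ⟨l, i'⟩
  · simp [K] at hpos
  rcases K_inr_inr_pos hpos with ⟨rfl, ha⟩ | ⟨rfl, ha⟩ | ⟨hl, ha⟩
  · exact step rfl ha fun y hy => hy.A1_mul_le n i i'
  · exact step rfl ha fun y hy => hy.A0_mul_le n i i'
  · obtain rfl : n = l := by lia
    rcases n with _ | n
    · exact ⟨i', _, ha, fun y hy => hy.Am_mul_le 0 i i'⟩
    · exact step rfl ha fun y hy => hy.Am_mul_le (n + 1) i i'

/-- Every state is reached from one level below by a way which stays above the initial level. -/
theorem exists_up (hK : D.K.IsIrreducible) (j : Fin m) :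
    ∃ i c, 0 < c ∧ ∀ y, D.IsInterior y → c * y 2 j ≤ y 1 i := by
  -- The state `.inr (n + 1, j)` is paired with level `n + 2` of `y`: paths are moved up by one
  -- level, because the row at level `0` is not an interior one.
  let s : Set (Index m₀ m) := {x | ∀ n j, x = .inr (n + 1, j) →
    ∃ i c, 0 < c ∧ ∀ y, D.IsInterior y → c * y (n + 2) j ≤ y 1 i}
  refine hK.mem_of_closed (s := s) ⟨.inr (0, j), by simp [s]⟩ ?_ (.inr (1, j)) 0 j rfl
  rintro x hx _ hpos n j rfl
  have step : ∀ {l : ℕ} {i' : Fin m} {a : ℝ}, x = .inr (l + 1, i') → 0 < a →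
      (∀ y, D.IsInterior y → a * y (n + 2) j ≤ y (l + 2) i') →
      ∃ i c, 0 < c ∧ ∀ y, D.IsInterior y → c * y (n + 2) j ≤ y 1 i := by
    intro l i' a hxl ha hle
    obtain ⟨i, c, hc, h⟩ := hx l i' hxl
    refine ⟨i, c * a, mul_pos hc ha, fun y hy => ?_⟩
    rw [mul_assoc]
    exact (mul_le_mul_of_nonneg_left (hle y hy) hc.le).trans (h y hy)
  rcases x with x | ⟨l, i'⟩
  · simp [K] at hpos
  rcases K_inr_inr_pos hpos with ⟨hl, ha⟩ | ⟨rfl, ha⟩ | ⟨rfl, ha⟩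
  · obtain rfl : n = l := by lia
    rcases n with _ | n
    · exact ⟨i', _, ha, fun y hy => hy.A1_mul_le 0 i' j⟩
    · exact step rfl ha fun y hy => hy.A1_mul_le (n + 1) i' j
  · exact step rfl ha fun y hy => hy.A0_mul_le (n + 1) i' j
  · exact step rfl ha fun y hy => hy.Am_mul_le (n + 2) i' j

theorem exists_pos_forall_le [NeZero m] {c : Fin m → ℝ} (hc : ∀ i, 0 < c i) :
    ∃ a, 0 < a ∧ ∀ i, a ≤ c i := by
  obtain ⟨o, ho⟩ := Finite.exists_min c
  exact ⟨c o, hc o, ho⟩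

theorem exists_down_uniform [NeZero m] (hK : D.K.IsIrreducible) :
    ∃ c, 0 < c ∧ ∀ y, D.IsInterior y → ∀ n i, ∃ j, c * y n j ≤ y (n + 1) i := by
  choose J c hc h using fun i => exists_down hK i
  obtain ⟨a, ha, hac⟩ := exists_pos_forall_le hc
  refine ⟨a, ha, fun y hy n i => ⟨J i, ?_⟩⟩
  have := h i _ (hy.shift n)
  rw [zero_add, add_comm 1 n] at this
  exact (mul_le_mul_of_nonneg_right (hac i) (hy.nonneg _ _)).trans this

theorem exists_up_uniform [NeZero m] (hK : D.K.IsIrreducible) :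
    ∃ c, 0 < c ∧ ∀ y, D.IsInterior y → ∀ n j, ∃ i, c * y (n + 2) j ≤ y (n + 1) i := by
  choose J c hc h using fun i => exists_up hK i
  obtain ⟨a, ha, hac⟩ := exists_pos_forall_le hc
  refine ⟨a, ha, fun y hy n i => ⟨J i, ?_⟩⟩
  have := h i _ (hy.shift n)
  rw [add_comm 1 n, add_comm 2 n] at this
  exact (mul_le_mul_of_nonneg_right (hac i) (hy.nonneg _ _)).trans this

theorem IsInterior.exists_geometric_bounds [NeZero m] (hK : D.K.IsIrreducible)
    {y : ℕ → Fin m → ℝ} (hy : D.IsInterior y) :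
    ∃ a b c C : ℝ, 0 < a ∧ 0 < c ∧ 0 < C ∧ (∀ n, a * c ^ n ≤ ∑ i, y (n + 1) i) ∧
      ∀ n, ∑ i, y (n + 1) i ≤ b * C ^ n := by
  obtain ⟨c, hc, hdown⟩ := exists_down_uniform hK
  obtain ⟨e, he, hup⟩ := exists_up_uniform hK
  obtain ⟨a, ha, hay⟩ := exists_pos_forall_le (hy.pos 1)
  obtain ⟨o, ho⟩ := Finite.exists_max (y 1)
  have h1 : ∀ n i, a * c ^ n ≤ y (n + 1) i := fun n => by
    induction n with
    | zero => simpa using hay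
    | succ n ih =>
      intro i
      obtain ⟨j, hj⟩ := hdown y hy (n + 1) i
      calc a * c ^ (n + 1) = c * (a * c ^ n) := by ring
        _ ≤ c * y (n + 1) j := mul_le_mul_of_nonneg_left (ih j) hc.le
        _ ≤ _ := hj
  have h2 : ∀ n i, y (n + 1) i ≤ y 1 o * e⁻¹ ^ n := fun n => by
    induction n with
    | zero => simpa using ho
    | succ n ih =>
      intro j
      obtain ⟨i, hi⟩ := hup y hy n j
      calc y (n + 2) j = e⁻¹ * (e * y (n + 2) j) := by field_simp
        _ ≤ e⁻¹ * (y 1 o * e⁻¹ ^ n) :=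
            mul_le_mul_of_nonneg_left (hi.trans (ih i)) (inv_pos.2 he).le
        _ = _ := by ring
  refine ⟨a, m * y 1 o, c, e⁻¹, ha, hc, inv_pos.2 he, fun n => ?_, fun n => ?_⟩
  · exact (h1 n 0).trans (Finset.single_le_sum (f := fun i => y (n + 1) i)
      (fun i _ => hy.nonneg _ i) (Finset.mem_univ 0))
  · refine (Finset.sum_le_sum fun i _ => h2 n i).trans (le_of_eq ?_)
    simp [mul_assoc]

theorem continuous_Astar : Continuous D.Astar := by
  unfold Astar
  fun_prop

/-- Compactness of normalised vectors. -/
theorem exists_subseq_tendsto {θ : ℕ → ℝ} {θ' : ℝ} (hθ : Tendsto θ atTop (𝓝 θ'))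
    {h : ℕ → Fin m → ℝ} (hh : ∀ k, h k ∈ stdSimplex ℝ (Fin m)) :
    ∃ h' ∈ stdSimplex ℝ (Fin m), ∃ φ : ℕ → ℕ, StrictMono φ ∧
      Tendsto (fun k => h (φ k)) atTop (𝓝 h') ∧
      Tendsto (fun k => D.Astar (θ (φ k)) *ᵥ h (φ k)) atTop (𝓝 (D.Astar θ' *ᵥ h')) := by
  obtain ⟨h', hh', φ, hφ, hlim⟩ :=
    (isCompact_stdSimplex (𝕜 := ℝ) (Fin m)).tendsto_subseq hh
  refine ⟨h', hh', φ, hφ, hlim, ?_⟩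
  refine tendsto_pi_nhds.2 fun i => ?_
  simp only [Matrix.mulVec, dotProduct]
  refine tendsto_finsetSum _ fun j _ => Tendsto.mul ?_ (tendsto_pi_nhds.1 hlim j)
  have hc : Continuous fun s => D.Astar s i j := continuous_Astar.matrix_elem i j
  exact (hc.tendsto θ').comp (hθ.comp hφ.tendsto_atTop)

theorem inv_sum_smul_mem_stdSimplex [NeZero m] {h : Fin m → ℝ} (hh : ∀ i, 0 < h i) :
    (∑ i, h i)⁻¹ • h ∈ stdSimplex ℝ (Fin m) := by
  have hsum : 0 < ∑ i, h i := Finset.sum_pos (fun i _ => hh i) Finset.univ_nonempty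
  refine ⟨fun i => mul_nonneg (inv_nonneg.2 hsum.le) (hh i).le, ?_⟩
  simp [← Finset.mul_sum, hsum.ne']

variable (D) in
/-- The parameters `θ` with a positive superharmonic vector for `A_*(θ)`. -/
def superSet : Set ℝ := {θ | ∃ h : Fin m → ℝ, (∀ i, 0 < h i) ∧ ∀ i, (D.Astar θ *ᵥ h) i ≤ h i}

/-- Normalised vectors have a limit point in the simplex. It could have zero entries, but
irreducibility of `A_*(θ')` makes it positive. -/
theorem mem_superSet_of_tendsto (hA : (D.Astar 0).IsIrreducible) {θ ε : ℕ → ℝ} {θ' : ℝ}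
    (hθ : Tendsto θ atTop (𝓝 θ')) (hε : Tendsto ε atTop (𝓝 0)) {h : ℕ → Fin m → ℝ}
    (hh : ∀ k, h k ∈ stdSimplex ℝ (Fin m))
    (hle : ∀ k i, (D.Astar (θ k) *ᵥ h k) i ≤ h k i + ε k) : θ' ∈ D.superSet := by
  obtain ⟨h', hh', φ, hφ, hlim, hAlim⟩ := exists_subseq_tendsto (D := D) hθ hh
  have hle' : ∀ i, (D.Astar θ' *ᵥ h') i ≤ h' i := fun i => by
    have h1 := (tendsto_pi_nhds.1 hlim i).add (hε.comp hφ.tendsto_atTop)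
    rw [add_zero] at h1
    exact le_of_tendsto_of_tendsto' (tendsto_pi_nhds.1 hAlim i) h1 fun k => hle (φ k) i
  exact ⟨h', pos_of_mem_stdSimplex (Astar_isIrreducible hA θ') hh' (r := 1) (by simpa using hle'),
    hle'⟩

/-- Multiplying the interior inequalities by `x ^ n` and summing from a level `M` gives `A_*(-log x)
F ≤ F` up to one boundary term in `A₁`. By `exists_radius`, `x` and `M` can be chosen so that this
term is negligible against `F` while `x → R`. -/
theorem superSet_nonempty [NeZero m] (hK : D.K.IsIrreducible) (hA : (D.Astar 0).IsIrreducible)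
    {y : ℕ → Fin m → ℝ} (hy : D.IsInterior y) : D.superSet.Nonempty := by
  obtain ⟨a, b, c, C, ha, hc, hC, hlow, hup⟩ := hy.exists_geometric_bounds hK
  obtain ⟨R, hR, hrad⟩ := exists_radius ha hc hC hlow hup
  have hε : ∀ k : ℕ, (0 : ℝ) < 1 / ((k : ℝ) + 1) := fun k => by positivity
  choose x hx hxR hsum M hM using fun k : ℕ => hrad _ (hε k)
  have hε0 : Tendsto (fun k : ℕ => 1 / ((k : ℝ) + 1)) atTop (𝓝 0) :=
    tendsto_one_div_add_atTop_nhds_zero_nat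
  have hxlim : Tendsto x atTop (𝓝 R) := by
    rw [tendsto_iff_norm_sub_tendsto_zero]
    exact squeeze_zero (fun k => norm_nonneg _) (fun k => (hxR k).le) hε0
  let f : ℕ → ℕ → Fin m → ℝ := fun k l => x k ^ (M k + l) • y (M k + l + 1)
  have hfpos : ∀ k l i, 0 < f k l i := fun k l i => mul_pos (pow_pos (hx k) _) (hy.pos _ i)
  have hfsum : ∀ k i, Summable fun l => f k l i := fun k i => by
    have h1 : Summable fun n => x k ^ n * y (n + 1) i := by
      refine Summable.of_nonneg_of_le (fun n => mul_nonneg (pow_pos (hx k) n).le (hy.nonneg _ i))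
        (fun n => ?_) (hsum k)
      rw [mul_comm]
      exact mul_le_mul_of_nonneg_right (Finset.single_le_sum (f := fun i => y (n + 1) i)
        (fun i _ => hy.nonneg _ i) (Finset.mem_univ i)) (pow_pos (hx k) n).le
    have h2 := (summable_nat_add_iff (M k)).2 h1
    simpa only [f, add_comm _ (M k), Pi.smul_apply, smul_eq_mul] using h2
  let F : ℕ → Fin m → ℝ := fun k i => ∑' l, f k l i
  have hF : ∀ k i, HasSum (fun l => f k l i) (F k i) := fun k i => (hfsum k i).hasSum
  have hFpos : ∀ k i, 0 < F k i := fun k i =>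
    (hfsum k i).tsum_pos (fun l => (hfpos k l i).le) 0 (hfpos k 0 i)
  have hFsum : ∀ k, ∑ i, f k 0 i ≤ 1 / ((k : ℝ) + 1) * ∑ i, F k i := fun k => by
    have h1 : ∑ i, F k i = ∑' l, (∑ i, y (M k + l + 1) i) * x k ^ (M k + l) := by
      simp only [F]
      rw [← Summable.tsum_finsetSum fun i _ => hfsum k i]
      refine tsum_congr fun l => ?_
      simp only [f, Pi.smul_apply, smul_eq_mul, ← Finset.mul_sum, mul_comm]
    rw [h1]
    refine le_trans (le_of_eq ?_) (hM k)
    simp only [f, Pi.smul_apply, smul_eq_mul, ← Finset.mul_sum, add_zero, mul_comm]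
  have hmv : ∀ (A : Matrix (Fin m) (Fin m) ℝ) {g : ℕ → Fin m → ℝ} {G : Fin m → ℝ},
      (∀ i, HasSum (fun l => g l i) (G i)) → ∀ i, HasSum (fun l => (A *ᵥ g l) i) ((A *ᵥ G) i) :=
    fun A g G hg i => by
      simp only [Matrix.mulVec, dotProduct]
      exact hasSum_sum fun j _ => (hg j).mul_left (A i j)
  have hmain : ∀ k i, (D.Astar (-Real.log (x k)) *ᵥ F k) i ≤
      F k i + (x k)⁻¹ * (D.A1 *ᵥ f k 0) i := fun k i => by
    have hxk := hx k
    have hF' : ∀ i, HasSum (fun l => f k (l + 1) i) ((F k - f k 0) i) := fun i => by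
      have := (hasSum_nat_add_iff' 1).2 (hF k i)
      simpa using this
    -- The three shifts differ: the `A₋₁` series is `x A₋₁ F` plus a nonnegative term `g 0`, which
    -- is dropped, while the `A₁` series is `x⁻¹ A₁ (F - f 0)`, whose missing term is the boundary
    -- error.
    let g : ℕ → ℝ := fun l => x k ^ (M k + l) * (D.Am *ᵥ y (M k + l)) i
    have hg : HasSum g (x k * (D.Am *ᵥ F k) i + g 0) := by
      have h1 : HasSum (fun l => g (l + 1)) (x k * (D.Am *ᵥ F k) i) := by
        have := (hmv D.Am (hF k) i).mul_left (x k)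
        refine this.congr_fun fun l => ?_
        simp only [g, f, Matrix.mulVec_smul, Pi.smul_apply, smul_eq_mul]
        rw [← add_assoc, pow_succ]
        ring
      have := (hasSum_nat_add_iff 1).1 h1
      simpa using this
    have hg0 : 0 ≤ g 0 := mul_nonneg (pow_pos hxk _).le (mulVec_nonneg D.Am_nonneg (hy.nonneg _) i)
    have hle := hasSum_le (fun l => ?_) ((hg.add (hmv D.A0 (hF k) i)).add
      ((hmv D.A1 hF' i).mul_left (x k)⁻¹)) (hF k i)
    · rw [Astar_mulVec, neg_neg, Real.exp_log hxk, Real.exp_neg, Real.exp_log hxk]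
      rw [Matrix.mulVec_sub, Pi.sub_apply, mul_sub] at hle
      linarith
    · have h1 := mul_le_mul_of_nonneg_left (hy.le (M k + l) i) (pow_pos hxk (M k + l)).le
      simp only [g, f, Matrix.mulVec_smul, Pi.smul_apply, smul_eq_mul]
      refine le_trans (le_of_eq ?_) h1
      rw [← add_assoc (M k) l 1, pow_succ]
      field_simp
  let α : ℝ := ∑ i, ∑ j, D.A1 i j
  have hA1 : ∀ k i, (D.A1 *ᵥ f k 0) i ≤ α * ∑ i, f k 0 i := fun k i => by
    have h0 : ∀ i, 0 ≤ ∑ j, D.A1 i j := fun i => Finset.sum_nonneg fun j _ => D.A1_nonneg i j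
    calc (D.A1 *ᵥ f k 0) i ≤ ∑ j, D.A1 i j * ∑ i, f k 0 i := by
          simp only [Matrix.mulVec, dotProduct]
          exact Finset.sum_le_sum fun j _ => mul_le_mul_of_nonneg_left
            (Finset.single_le_sum (f := fun i => f k 0 i) (fun i _ => (hfpos k 0 i).le)
              (Finset.mem_univ j)) (D.A1_nonneg i j)
      _ = (∑ j, D.A1 i j) * ∑ i, f k 0 i := by rw [Finset.sum_mul]
      _ ≤ α * ∑ i, f k 0 i := mul_le_mul_of_nonneg_right
          (Finset.single_le_sum (f := fun i => ∑ j, D.A1 i j) (fun i _ => h0 i)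
            (Finset.mem_univ i)) (Finset.sum_nonneg fun i _ => (hfpos k 0 i).le)
  have hα : 0 ≤ α := Finset.sum_nonneg fun i _ => Finset.sum_nonneg fun j _ => D.A1_nonneg i j
  refine ⟨-Real.log R, mem_superSet_of_tendsto hA (θ := fun k => -Real.log (x k))
    (ε := fun k => (x k)⁻¹ * (α * (1 / ((k : ℝ) + 1)))) (h := fun k => (∑ i, F k i)⁻¹ • F k)
    ?_ ?_ (fun k => inv_sum_smul_mem_stdSimplex (hFpos k)) fun k i => ?_⟩
  · exact ((Real.continuousAt_log hR.ne').tendsto.comp hxlim).neg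
  · simpa using (hxlim.inv₀ hR.ne').mul (hε0.const_mul α)
  · have hsp : 0 < ∑ i, F k i := Finset.sum_pos (fun i _ => hFpos k i) Finset.univ_nonempty
    have hxi : 0 ≤ (x k)⁻¹ := (inv_pos.2 (hx k)).le
    have h1 : (D.Astar (-Real.log (x k)) *ᵥ F k) i ≤
        F k i + (x k)⁻¹ * (α * (1 / ((k : ℝ) + 1))) * ∑ i, F k i := by
      refine (hmain k i).trans ?_
      rw [mul_assoc, mul_assoc]
      gcongr
      exact (hA1 k i).trans (mul_le_mul_of_nonneg_left (hFsum k) hα)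
    simp only [Matrix.mulVec_smul, Pi.smul_apply, smul_eq_mul]
    refine (mul_le_mul_of_nonneg_left h1 (inv_pos.2 hsp).le).trans (le_of_eq ?_)
    field_simp

theorem isClosed_superSet [NeZero m] (hA : (D.Astar 0).IsIrreducible) : IsClosed D.superSet := by
  refine IsSeqClosed.isClosed fun θ θ' hmem hlim => ?_
  choose h hpos hle using hmem
  refine mem_superSet_of_tendsto hA hlim tendsto_const_nhds
    (fun k => inv_sum_smul_mem_stdSimplex (hpos k)) fun k i => ?_
  have hsum : 0 < ∑ i, h k i := Finset.sum_pos (fun i _ => hpos k i) Finset.univ_nonempty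
  simp only [Matrix.mulVec_smul, Pi.smul_apply, smul_eq_mul, add_zero]
  exact mul_le_mul_of_nonneg_left (hle k i) (inv_pos.2 hsum).le

/-- The uniform way down, applied to `e^{nθ} h` at an index where `h` is least, forces `c ≤ e^θ`. -/
theorem bddBelow_superSet [NeZero m] (hK : D.K.IsIrreducible) : BddBelow D.superSet := by
  obtain ⟨c, hc, hdown⟩ := exists_down_uniform hK
  refine ⟨Real.log c, fun θ ⟨h, hh, hle⟩ => ?_⟩
  obtain ⟨o, ho⟩ := Finite.exists_min h
  obtain ⟨j, hj⟩ := hdown _ (isInterior_exp hh hle) 0 o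
  simp only [Nat.cast_zero, zero_mul, Real.exp_zero, zero_add, Nat.cast_one, one_mul,
    Pi.smul_apply, smul_eq_mul] at hj
  rw [Real.log_le_iff_le_exp hc]
  have h1 : c * h j ≤ Real.exp θ * h j :=
    hj.trans (mul_le_mul_of_nonneg_left (ho j) (Real.exp_pos θ).le)
  exact le_of_mul_le_mul_right h1 (hh j)

/-- The left end point of the set of `θ` with `γ(θ) ≤ 1`, with its eigenvector obtained as a limit
of Perron-Frobenius eigenvectors for parameters with `γ > 1`. -/
theorem exists_critical [NeZero m] (hK : D.K.IsIrreducible) (hA : (D.Astar 0).IsIrreducible)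
    {y : ℕ → Fin m → ℝ} (hy : D.IsInterior y) :
    ∃ (θ' : ℝ) (h' : Fin m → ℝ), (∀ i, 0 < h' i) ∧ D.Astar θ' *ᵥ h' = h' ∧
      ∃ (θ r : ℕ → ℝ) (h : ℕ → Fin m → ℝ), Tendsto θ atTop (𝓝 θ') ∧ Tendsto h atTop (𝓝 h') ∧
        ∀ k, θ k < θ' ∧ 1 < r k ∧ (∀ i, 0 < h k i) ∧ D.Astar (θ k) *ᵥ h k = r k • h k := by
  have hne := superSet_nonempty hK hA hy
  have hbdd := bddBelow_superSet hK
  set θ' := sInf D.superSet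
  obtain ⟨g, hg, hgle⟩ : θ' ∈ D.superSet := (isClosed_superSet hA).csInf_mem hne hbdd
  let θ : ℕ → ℝ := fun k => θ' - 1 / ((k : ℝ) + 1)
  have hθlt : ∀ k, θ k < θ' := fun k => sub_lt_self _ (by positivity)
  have hθ : Tendsto θ atTop (𝓝 θ') := by
    simpa [θ] using (tendsto_const_nhds (x := θ')).sub (tendsto_one_div_add_atTop_nhds_zero_nat (𝕜 := ℝ))
  choose r h hpos hsum heig using fun k => exists_pos_eigenvector (Astar_isIrreducible hA (θ k))
  have hr : ∀ k, 1 < r k := fun k => by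
    by_contra! hr
    refine absurd (csInf_le hbdd ⟨h k, hpos k, fun i => ?_⟩) (not_le.2 (hθlt k))
    rw [heig k]
    exact mul_le_of_le_one_left (hpos k i).le hr
  obtain ⟨h', hh', φ, hφ, hlim, hAlim⟩ := exists_subseq_tendsto (D := D) hθ (h := h)
    fun k => ⟨fun i => (hpos k i).le, hsum k⟩
  -- As the entries of `h k` add up to `1`, the eigenvalue is the sum of the entries of `A_*(θ k) h
  -- k`.
  have hrlim : Tendsto (fun k => r (φ k)) atTop (𝓝 (∑ i, (D.Astar θ' *ᵥ h') i)) := by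
    have h1 := tendsto_finsetSum Finset.univ fun i _ => tendsto_pi_nhds.1 hAlim i
    refine h1.congr fun k => ?_
    rw [heig]
    simp [← Finset.mul_sum, hsum]
  set s := ∑ i, (D.Astar θ' *ᵥ h') i
  have heig' : D.Astar θ' *ᵥ h' = s • h' := by
    refine tendsto_nhds_unique hAlim ?_
    simp only [heig]
    exact hrlim.smul hlim
  have heigi : ∀ i, (D.Astar θ' *ᵥ h') i = s * h' i := fun i => by rw [heig']; rfl
  have hpos' := pos_of_mem_stdSimplex (Astar_isIrreducible hA θ') hh' fun i => (heigi i).le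
  -- At most `1` because `θ'` has a superharmonic vector, at least `1` as a limit of eigenvalues
  -- above `1`.
  have hs : s = 1 := le_antisymm
    (eigenvalue_le (D.Astar_nonneg θ') hpos' hg (fun i => (heigi i).ge) (by simpa using hgle))
    (ge_of_tendsto' hrlim fun k => (hr _).le)
  refine ⟨θ', h', hpos', by rw [heig', hs, one_smul], fun k => θ (φ k), fun k => r (φ k),
    fun k => h (φ k), hθ.comp hφ.tendsto_atTop, hlim, fun k => ⟨hθlt _, hr _, hpos _, heig _⟩⟩

end Blocks

/-! ### Minimality of the critical exponential and the converse in (b) -/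

namespace Blocks

variable {m₀ m : ℕ} {D : Blocks m₀ m}

/-- Comparison of an interior superharmonic vector with an exponential subharmonic one. -/
theorem IsInterior.exp_le_of_one_lt {y : ℕ → Fin m → ℝ} (hy : D.IsInterior y) {θ θ' r : ℝ}
    {h h' : Fin m → ℝ} (hθ : θ < θ') (hr : 1 < r) (hh' : ∀ i, 0 < h' i)
    (heig : D.Astar θ *ᵥ h = r • h) (heig' : D.Astar θ' *ᵥ h' = h') (h0 : ∀ i, h i ≤ y 0 i)
    (n : ℕ) (i : Fin m) : Real.exp (n * θ) * h i ≤ y n i := by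
  suffices key : ∀ ε, 0 < ε →
      Real.exp (n * θ) * h i - ε * (Real.exp (n * θ') * h' i) ≤ y n i by
    refine le_of_forall_pos_le_add fun δ hδ => ?_
    have hp : 0 < Real.exp (n * θ') * h' i := mul_pos (Real.exp_pos _) (hh' i)
    have := key (δ / (Real.exp (n * θ') * h' i)) (div_pos hδ hp)
    rw [div_mul_cancel₀ _ hp.ne'] at this
    linarith
  intro ε hε
  -- As `θ < θ'`, the subtracted term makes `φ` nonpositive at high levels, so only finitely many
  -- levels matter in a maximum principle. It costs nothing in the interior, where `e^{nθ'} h'` is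
  -- harmonic.
  let φ : ℕ → Fin m → ℝ := fun n => Real.exp (n * θ) • h - ε • (Real.exp (n * θ') • h')
  obtain ⟨N, hN⟩ : ∃ N, ∀ n ≥ N, ∀ i, φ n i ≤ 0 := by
    have hlim : Tendsto (fun n : ℕ => Real.exp (n * (θ' - θ))) atTop atTop :=
      Real.tendsto_exp_atTop.comp
        (tendsto_natCast_atTop_atTop.atTop_mul_const (sub_pos.2 hθ))
    have hev : ∀ᶠ n : ℕ in atTop, ∀ i, h i / (ε * h' i) ≤ Real.exp (n * (θ' - θ)) :=
      eventually_all.2 fun i => hlim.eventually_ge_atTop _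
    obtain ⟨N, hN⟩ := eventually_atTop.1 hev
    refine ⟨N, fun n hn i => sub_nonpos.2 ?_⟩
    have h1 := (div_le_iff₀ (mul_pos hε (hh' i))).1 (hN n hn i)
    have h2 : Real.exp (n * θ') = Real.exp (n * θ) * Real.exp (n * (θ' - θ)) := by
      rw [← Real.exp_add]
      ring_nf
    simp only [Pi.smul_apply, smul_eq_mul]
    rw [h2]
    refine (mul_le_mul_of_nonneg_left h1 (Real.exp_pos _).le).trans (le_of_eq ?_)
    ring
  have hφ0 : ∀ i, φ 0 i ≤ y 0 i := fun i => by
    have : 0 < ε * h' i := mul_pos hε (hh' i)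
    simp only [φ, Nat.cast_zero, zero_mul, Real.exp_zero, one_smul, Pi.sub_apply, Pi.smul_apply,
      smul_eq_mul]
    linarith [h0 i]
  have hφA : ∀ n i, r * φ (n + 1) i ≤
      (D.Am *ᵥ φ n) i + (D.A0 *ᵥ φ (n + 1)) i + (D.A1 *ᵥ φ (n + 2)) i := fun n i => by
    have e1 := interior_exp (D := D) θ h n i
    have e2 := interior_exp (D := D) θ' h' n i
    rw [heig] at e1
    rw [heig'] at e2
    simp only [φ, Matrix.mulVec_sub, Pi.sub_apply]
    rw [Matrix.mulVec_smul _ ε, Matrix.mulVec_smul _ ε, Matrix.mulVec_smul _ ε]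
    simp only [Pi.smul_apply, smul_eq_mul] at e1 e2 ⊢
    have h3 : 0 ≤ (r - 1) * (ε * (Real.exp ((n + 1 : ℕ) * θ') * h' i)) :=
      mul_nonneg (by linarith) (mul_pos hε (mul_pos (Real.exp_pos _) (hh' i))).le
    linear_combination h3 - e1 + ε * e2
  by_contra! hcon
  change y n i < φ n i at hcon
  have hnN : n < N := by
    by_contra! h
    linarith [hN n h i, hy.pos n i]
  obtain ⟨⟨p, o⟩, -, hmax⟩ := Finset.exists_max_image
    (Finset.range N ×ˢ (Finset.univ : Finset (Fin m))) (fun q => φ q.1 q.2 / y q.1 q.2)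
    ⟨(n, i), by simpa using hnN⟩
  set t := φ p o / y p o with ht
  have ht1 : 1 < t := ((one_lt_div (hy.pos n i)).2 hcon).trans_le (hmax (n, i) (by simpa using hnN))
  have hty : ∀ k j, φ k j ≤ (t • y k) j := fun k j => by
    by_cases hk : k < N
    · exact (div_le_iff₀ (hy.pos k j)).1 (hmax (k, j) (by simpa using hk))
    · exact (hN k (not_lt.1 hk) j).trans (mul_pos (by linarith) (hy.pos k j)).le
  have hto : t * y p o = φ p o := div_mul_cancel₀ _ (hy.pos p o).ne'
  -- At the maximum, level `0` contradicts `φ 0 ≤ y 0`. Above it, `r φ ≤ t y = φ` contradicts `r >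
  -- 1`; this strictness dispenses with a strong maximum principle.
  rcases p with _ | p
  · nlinarith [hφ0 o, hy.pos 0 o]
  · have h1 := mulVec_mono D.Am_nonneg (hty p) o
    have h2 := mulVec_mono D.A0_nonneg (hty (p + 1)) o
    have h3 := mulVec_mono D.A1_nonneg (hty (p + 2)) o
    simp only [Matrix.mulVec_smul, Pi.smul_apply, smul_eq_mul] at h1 h2 h3
    have h4 := mul_le_mul_of_nonneg_left (hy.le p o) (by linarith : 0 ≤ t)
    have h5 : 0 < t * y (p + 1) o := mul_pos (by linarith) (hy.pos _ o)
    have h6 := hφA p o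
    nlinarith

/-- The strict comparison is unavailable at `θ'` itself, where the eigenvalue is `1`. It is applied
at `θ k < θ'` to `s y` with `s > 1`, the slack absorbing `h k ≤ s h'` for large `k`; then `k → ∞`
and `s → 1`. -/
theorem IsInterior.exp_le {y : ℕ → Fin m → ℝ} (hy : D.IsInterior y) {θ' : ℝ}
    {h' : Fin m → ℝ} (hh' : ∀ i, 0 < h' i) (heig' : D.Astar θ' *ᵥ h' = h')
    {θ r : ℕ → ℝ} {h : ℕ → Fin m → ℝ} (hθ : Tendsto θ atTop (𝓝 θ')) (hh : Tendsto h atTop (𝓝 h'))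
    (hseq : ∀ k, θ k < θ' ∧ 1 < r k ∧ (∀ i, 0 < h k i) ∧ D.Astar (θ k) *ᵥ h k = r k • h k)
    (h0 : ∀ i, h' i ≤ y 0 i) (n : ℕ) (i : Fin m) : Real.exp (n * θ') * h' i ≤ y n i := by
  have key : ∀ s : ℝ, 1 < s → Real.exp (n * θ') * h' i ≤ s * y n i := fun s hs => by
    have hs0 : 0 < s := by linarith
    have hev : ∀ᶠ k in atTop, ∀ i, h k i ≤ s * h' i := eventually_all.2 fun i =>
      ((tendsto_pi_nhds.1 hh i).eventually_lt_const
        (lt_mul_of_one_lt_left (hh' i) hs)).mono fun _ => le_of_lt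
    have hlim : Tendsto (fun k => Real.exp (n * θ k) * h k i) atTop
        (𝓝 (Real.exp (n * θ') * h' i)) :=
      ((Real.continuous_exp.tendsto _).comp (hθ.const_mul _)).mul (tendsto_pi_nhds.1 hh i)
    refine le_of_tendsto hlim (hev.mono fun k hk => ?_)
    obtain ⟨h1, h2, -, h4⟩ := hseq k
    exact (hy.smul hs0).exp_le_of_one_lt h1 h2 hh' h4 heig'
      (fun i => (hk i).trans (mul_le_mul_of_nonneg_left (h0 i) hs0.le)) n i
  have hlim : Tendsto (fun s : ℝ => s * y n i) (𝓝[>] 1) (𝓝 (1 * y n i)) :=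
    ((continuous_mul_const (y n i)).tendsto 1).mono_left nhdsWithin_le_nhds
  rw [one_mul] at hlim
  exact ge_of_tendsto hlim (eventually_nhdsWithin_of_forall fun s hs => key s hs)

theorem GammaE_nonempty [NeZero m₀] [NeZero m] (hK : D.K.IsIrreducible)
    (hA : (D.Astar 0).IsIrreducible) (hkey : D.KeyAssumption)
    {y : Index m₀ m → ℝ} (hy : IsSuperharmonic D.K y) : D.GammaE.Nonempty := by
  obtain ⟨y₀, Y, rfl⟩ : ∃ (y₀ : Fin m₀ → ℝ) (Y : ℕ → Fin m → ℝ),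
      y = Sum.elim y₀ fun p => Y p.1 p.2 :=
    ⟨fun i => y (.inl i), fun n i => y (.inr (n, i)), by ext (i | ⟨n, i⟩) <;> rfl⟩
  have hp₀ : ∀ i, 0 < y₀ i := fun i => hy.1 (.inl i)
  have hp : ∀ n i, 0 < Y n i := fun n i => hy.1 (.inr (n, i))
  obtain ⟨hrow0, hrow1, hrow2⟩ := (D.tsum_K_le_iff (fun i => (hp₀ i).le)
    (fun n i => (hp n i).le)).1 hy.2
  have hY : D.IsInterior Y := ⟨hp, hrow2⟩
  obtain ⟨θ, h, hh, heig, θs, r, hs, hθs, hhs, hseq⟩ := exists_critical hK hA hY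
  have hpf : pfEigenvalue (D.Astar θ) = 1 :=
    pfEigenvalue_eq (D.Astar_nonneg θ) hh (by rw [heig, one_smul])
  obtain ⟨h₀, c₀, c₁, hh₀, hc, hB, hC⟩ := hkey θ hpf.le h hh (by rw [heig, hpf, one_smul])
  have hBi : ∀ i, (D.B0 *ᵥ h₀) i + Real.exp θ * (D.B1 *ᵥ h) i = c₀ * h₀ i := fun i =>
    congrFun hB i
  have hCi : ∀ i, Real.exp (-θ) * (D.Bm *ᵥ h₀) i + (D.A0 *ᵥ h) i + Real.exp θ * (D.A1 *ᵥ h) i =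
    c₁ * h i := fun i => congrFun hC i
  suffices hle : c₀ ≤ 1 ∧ c₁ ≤ 1 by
    refine ⟨θ, h, hh, heig, Cstar_mulVec_le hh hh₀ (fun i => ?_) fun i => ?_⟩
    · rw [hBi]
      exact mul_le_of_le_one_left (hh₀ i).le hle.1
    · rw [hCi]
      exact mul_le_of_le_one_left (hh i).le hle.2
  by_contra hnot
  -- One of the factors equals `1`, so the failure of the bounds means that the other exceeds `1`;
  -- this makes the vector with blocks `h₀` and `Z n` subharmonic.
  have hge : 1 ≤ c₀ ∧ 1 ≤ c₁ := by
    rcases hc with rfl | rfl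
    · exact ⟨le_rfl, (not_le.1 fun h => hnot ⟨le_rfl, h⟩).le⟩
    · exact ⟨(not_le.1 fun h => hnot ⟨h, le_rfl⟩).le, le_rfl⟩
  let Z : ℕ → Fin m → ℝ := fun n => Real.exp ((n + 1 : ℕ) * θ) • h
  have hZp : ∀ n i, 0 < Z n i := fun n i => mul_pos (Real.exp_pos _) (hh i)
  have hZ0 : Z 0 = Real.exp θ • h := by simp [Z]
  have hZ1 : Z 1 = Real.exp θ • Real.exp θ • h := by
    simp only [Z, smul_smul, ← Real.exp_add]
    congr 2
    push_cast
    ring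
  have hZrow0 : ∀ i, (D.B0 *ᵥ h₀) i + (D.B1 *ᵥ Z 0) i = c₀ * h₀ i := fun i => by
    rw [hZ0, Matrix.mulVec_smul]
    exact hBi i
  have hZrow1 : ∀ i, (D.Bm *ᵥ h₀) i + (D.A0 *ᵥ Z 0) i + (D.A1 *ᵥ Z 1) i = c₁ * Z 0 i :=
      fun i => by
    have he : Real.exp θ * Real.exp (-θ) = 1 := by rw [← Real.exp_add]; simp
    rw [hZ0, hZ1]
    simp only [Matrix.mulVec_smul, Pi.smul_apply, smul_eq_mul]
    linear_combination Real.exp θ * hCi i - (D.Bm *ᵥ h₀) i * he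
  have hZrow2 : ∀ n i, (D.Am *ᵥ Z n) i + (D.A0 *ᵥ Z (n + 1)) i + (D.A1 *ᵥ Z (n + 2)) i =
      Z (n + 1) i := fun n i => by
    have := interior_exp (D := D) θ h (n + 1) i
    rw [heig] at this
    exact this
  -- the least multiple of `y` which dominates on the first two blocks
  let q : Fin m₀ ⊕ Fin m → ℝ := Sum.elim (fun i => h₀ i / y₀ i) fun i => Z 0 i / Y 0 i
  obtain ⟨o, ho⟩ := Finite.exists_max q
  set t := q o with ht
  have hle₀ : ∀ i, h₀ i ≤ t * y₀ i := fun i => (div_le_iff₀ (hp₀ i)).1 (ho (.inl i))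
  have hle0 : ∀ i, Z 0 i ≤ t * Y 0 i := fun i => (div_le_iff₀ (hp 0 i)).1 (ho (.inr i))
  have htpos : 0 < t := (div_pos (hh₀ 0) (hp₀ 0)).trans_le (ho (.inl 0))
  -- Domination at level `0` spreads to all levels by minimality, applied to `e^{-θ} t Y` because `Z
  -- 0 = e^θ h`.
  have hle : ∀ n i, Z n i ≤ t * Y n i := fun n i => by
    have hexp : 0 < Real.exp (-θ) * t := mul_pos (Real.exp_pos _) htpos
    have he : Real.exp θ * Real.exp (-θ) = 1 := by rw [← Real.exp_add]; simp
    have h1 := (hY.smul hexp).exp_le hh heig hθs hhs hseq (fun i => ?_) n i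
    · have h2 := mul_le_mul_of_nonneg_left h1 (Real.exp_pos θ).le
      have h3 : Z n i = Real.exp θ * (Real.exp (n * θ) * h i) := by
        simp only [Z, Pi.smul_apply, smul_eq_mul]
        rw [← mul_assoc, ← Real.exp_add]
        push_cast
        ring_nf
      rw [h3]
      refine h2.trans (le_of_eq ?_)
      simp only [Pi.smul_apply, smul_eq_mul]
      linear_combination (t * Y n i) * he
    · have h2 := mul_le_mul_of_nonneg_left (hle0 i) (Real.exp_pos (-θ)).le
      rw [hZ0] at h2
      simp only [Pi.smul_apply, smul_eq_mul] at h2 ⊢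
      linear_combination h2 - h i * he
  let v₀ : Fin m₀ → ℝ := t • y₀ - h₀
  let V : ℕ → Fin m → ℝ := fun n => t • Y n - Z n
  have hv₀ : ∀ i, 0 ≤ v₀ i := fun i => sub_nonneg.2 (hle₀ i)
  have hV : ∀ n i, 0 ≤ V n i := fun n i => sub_nonneg.2 (hle n i)
  have hsuper := (D.tsum_K_le_iff hv₀ hV).2 ⟨fun i => ?_, fun i => ?_, fun n i => ?_⟩
  · obtain ⟨x, hx⟩ : ∃ x : Index m₀ m, Sum.elim v₀ (fun p => V p.1 p.2) x = 0 := by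
      rcases hoe : o with i | i
      · refine ⟨.inl i, sub_eq_zero.2 ?_⟩
        have : t = h₀ i / y₀ i := by rw [ht, hoe]; rfl
        simp only [Pi.smul_apply, smul_eq_mul]
        rw [this, div_mul_cancel₀ _ (hp₀ i).ne']
      · refine ⟨.inr (0, i), sub_eq_zero.2 ?_⟩
        have : t = Z 0 i / Y 0 i := by rw [ht, hoe]; rfl
        simp only [Pi.smul_apply, smul_eq_mul]
        rw [this, div_mul_cancel₀ _ (hp 0 i).ne']
    -- A positive entry of the superharmonic difference would make all entries nonzero, against its
    -- zero at the index attaining `t`.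
    have hzero : ∀ x : Index m₀ m, Sum.elim v₀ (fun p => V p.1 p.2) x ≤ 0 := by
      intro x'
      by_contra! hpos
      refine (exists_isSuperharmonic hK _ x' ?_ ENNReal.ofReal_ne_top hsuper).1 x (by simp [hx])
      simpa using hpos
    have hz₀ : t • y₀ = h₀ := funext fun i => le_antisymm (sub_nonpos.1 (hzero (.inl i))) (hle₀ i)
    have hz : ∀ n, t • Y n = Z n := fun n => funext fun i =>
      le_antisymm (sub_nonpos.1 (hzero (.inr (n, i)))) (hle n i)
    -- Now `Z` is a multiple of the superharmonic vector, and one entry of each boundary row bounds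
    -- the corresponding factor.
    refine hnot ⟨?_, ?_⟩
    · refine le_of_mul_le_mul_right ?_ (hh₀ 0)
      rw [← hZrow0, ← hz, ← hz₀]
      simp only [Matrix.mulVec_smul, Pi.smul_apply, smul_eq_mul, one_mul]
      rw [← mul_add]
      exact mul_le_mul_of_nonneg_left (hrow0 0) htpos.le
    · refine le_of_mul_le_mul_right ?_ (hZp 0 0)
      rw [← hZrow1, ← hz, ← hz, ← hz₀]
      simp only [Matrix.mulVec_smul, Pi.smul_apply, smul_eq_mul, one_mul]
      rw [← mul_add, ← mul_add]
      exact mul_le_mul_of_nonneg_left (hrow1 0) htpos.le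
  · have h1 := mul_le_mul_of_nonneg_left (hrow0 i) htpos.le
    have h2 := le_mul_of_one_le_left (hh₀ i).le hge.1
    have h3 := hZrow0 i
    simp only [v₀, V, Matrix.mulVec_sub, Matrix.mulVec_smul, Pi.sub_apply, Pi.smul_apply,
      smul_eq_mul]
    linarith
  · have h1 := mul_le_mul_of_nonneg_left (hrow1 i) htpos.le
    have h2 := le_mul_of_one_le_left (hZp 0 i).le hge.2
    have h3 := hZrow1 i
    simp only [v₀, V, Matrix.mulVec_sub, Matrix.mulVec_smul, Pi.sub_apply, Pi.smul_apply,
      smul_eq_mul]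
    linarith
  · have h1 := mul_le_mul_of_nonneg_left (hrow2 n i) htpos.le
    have h3 := hZrow2 n i
    simp only [V, Matrix.mulVec_sub, Matrix.mulVec_smul, Pi.sub_apply, Pi.smul_apply,
      smul_eq_mul]
    linarith

theorem GammaE_subset_GammaD : D.GammaE ⊆ D.GammaD := by
  rintro θ ⟨h, hh, hAh, hCh⟩
  exact ⟨h, hh, fun i => (congrFun hAh i).le, hCh⟩

end Blocks

end QBD

end

theorem mainTheorem1 {m₀ m : ℕ} (hm₀ : 0 < m₀) (hm : 0 < m) (D : QBD.Blocks m₀ m)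
    (hK : D.K.IsIrreducible) (hA : (D.Astar 0).IsIrreducible) :
    (1 ≤ QBD.convParam D.K ↔ ∃ y, QBD.IsSuperharmonic D.K y) ∧
    (D.GammaD.Nonempty → 1 ≤ QBD.convParam D.K) ∧
    (D.KeyAssumption →
      (1 ≤ QBD.convParam D.K ↔ D.GammaD.Nonempty) ∧
      (1 ≤ QBD.convParam D.K ↔ D.GammaE.Nonempty)) := by
  have : NeZero m₀ := ⟨hm₀.ne'⟩
  have : NeZero m := ⟨hm.ne'⟩
  have h1 : 1 ≤ QBD.convParam D.K ↔ ∃ y, QBD.IsSuperharmonic D.K y :=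
    ⟨QBD.exists_isSuperharmonic_of_one_le_convParam hK,
      fun ⟨_, hy⟩ => QBD.one_le_convParam_of_isSuperharmonic hy⟩
  have ha : D.GammaD.Nonempty → 1 ≤ QBD.convParam D.K := fun h =>
    h1.2 (QBD.Blocks.exists_isSuperharmonic_of_GammaD_nonempty hm hK h)
  refine ⟨h1, ha, fun hkey => ?_⟩
  have hb : 1 ≤ QBD.convParam D.K → D.GammaE.Nonempty := fun h => by
    obtain ⟨y, hy⟩ := h1.1 h
    exact QBD.Blocks.GammaE_nonempty hK hA hkey hy
  exact ⟨⟨fun h => (hb h).mono QBD.Blocks.GammaE_subset_GammaD, ha⟩,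
    ⟨hb, fun h => ha (h.mono QBD.Blocks.GammaE_subset_GammaD)⟩⟩
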